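/- Let $R$ be a ring. Write $\mathrm{Mod}(R)$ for the category of right $R$-modules, $\mathrm{mod}(R^{op})$ for the category of finitely presented left $R$-modules, and $(\mathrm{mod}(R^{op}),\mathrm{Ab})$ for the category of additive functors $\mathrm{mod}(R^{op})\to\mathrm{Ab}$ and natural transformations. Let $\mathrm{fp}(\mathrm{Mod}(R),\mathrm{Ab})$ be the category of finitely presented functors, i.e. functors $F:\mathrm{Mod}(R)\to\mathrm{Ab}$ for which there is a sequence of natural transformations $\mathrm{Hom}_R(Y,-)\to \mathrm{Hom}_R(X,-)\to F\to 0$, with $X,Y\in\mathrm{Mod}(R)$, that is exact at every module. Let $w:\mathrm{fp}(\mathrm{Mod}(R),\mathrm{Ab})^{op}\to\mathrm{Mod}(R)$ be the functor with $w(F)=\ker(X\to Y)$, where $X\to Y$ is the homomorphism inducing $\mathrm{Hom}_R(Y,-)\to \mathrm{Hom}_R(X,-)$ in a presentation of $F$, and let $t:\mathrm{Mod}(R)\to(\mathrm{mod}(R^{op}),\mathrm{Ab})$ be $t(X)=X\otimes_R-$. The Auslander-Gruson-Jensen functor is the zeroth derived functor $D_A=R_0(t\circ w):\mathrm{fp}(\mathrm{Mod}(R),\mathrm{Ab})^{op}\to(\mathrm{mod}(R^{op}),\mathrm{Ab})$,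 computed by projective resolutions: $D_A F$ is the kernel of $tw(\mathrm{Hom}_R(X,-))\to tw(\mathrm{Hom}_R(Y,-))$ for a presentation of $F$ as above. For $G\in(\mathrm{mod}(R^{op}),\mathrm{Ab})$ and $X\in\mathrm{Mod}(R)$ put $$(D_R G)(X)=\mathrm{Nat}(G,\,X\otimes_R-),$$ which is functorial in $X$ and contravariantly functorial in $G$. **Theorem.** For every $G\in(\mathrm{mod}(R^{op}),\mathrm{Ab})$ the functor $D_RG$ is finitely presented. The resulting functor $D_R:(\mathrm{mod}(R^{op}),\mathrm{Ab})^{op}\to\mathrm{fp}(\mathrm{Mod}(R),\mathrm{Ab})$ is additive, fully faithful, and right adjoint to $D_A:\mathrm{fp}(\mathrm{Mod}(R),\mathrm{Ab})\to(\mathrm{mod}(R^{op}),\mathrm{Ab})^{op}$. That is, for all $F\in\mathrm{fp}(\mathrm{Mod}(R),\mathrm{Ab})$ and $G\in(\mathrm{mod}(R^{op}),\mathrm{Ab})$ there is an isomorphism of abelian groups $$\mathrm{Nat}(F,D_RG)\cong\mathrm{Nat}(G,D_AF)$$ natural in $F$ and $G$. -/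

import Mathlib

open CategoryTheory CategoryTheory.Limits Opposite
open scoped TensorProduct MulOpposite

universe w v v' u u'

noncomputable section

namespace AGJ

/-! ## Finitely presented functors -/

section FinitelyPresented

variable {C : Type u} [Category.{v} C] [Preadditive C]

/-- A presentation `(Y, -) ⟶ (X, -) ⟶ F ⟶ 0` of a functor `F` by representable functors, exact
after evaluation at every object. By the Yoneda lemma the first map is `(f, -)` for a unique
morphism `f : X ⟶ Y`. -/
structure Presentation (F : C ⥤ AddCommGrpCat.{v}) where
  {X : C}
  {Y : C}
  f : X ⟶ Y
  ε : preadditiveCoyoneda.obj (op X) ⟶ F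
  exact (A : C) : Function.Exact ((preadditiveCoyoneda.map f.op).app A) (ε.app A)
  surjective (A : C) : Function.Surjective (ε.app A)

variable (C) in
/-- The property of being a finitely presented functor. (A finitely presented functor is
automatically additive, see `Presentation.additive`.) -/
def isFp : ObjectProperty (C ⥤ AddCommGrpCat.{v}) := fun F => Nonempty (Presentation F)

variable (C) in
/-- The category `fp(C, Ab)` of finitely presented functors and natural transformations. -/
abbrev Fp := (isFp C).FullSubcategory

/-- A chosen presentation of a finitely presented functor. -/
def Fp.pres (F : Fp C) : Presentation F.obj := F.property.some

/-- The generator `ε(1_X) ∈ F(X)` of a presentation. -/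
def Presentation.gen {F : C ⥤ AddCommGrpCat.{v}} (p : Presentation F) : F.obj p.X :=
  p.ε.app p.X (𝟙 p.X)

lemma Presentation.ε_apply {F : C ⥤ AddCommGrpCat.{v}} (p : Presentation F) {A : C}
    (a : p.X ⟶ A) : p.ε.app A a = F.map a p.gen := by
  have h := ConcreteCategory.congr_hom (p.ε.naturality a) (𝟙 p.X)
  have h' : p.ε.app A (𝟙 p.X ≫ a) = F.map a (p.ε.app p.X (𝟙 p.X)) := h
  simpa [Presentation.gen] using h'

lemma Presentation.map_f_gen {F : C ⥤ AddCommGrpCat.{v}} (p : Presentation F) :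
    F.map p.f p.gen = 0 := by
  rw [← p.ε_apply]
  exact (p.exact p.Y p.f).2 ⟨𝟙 p.Y, Category.comp_id p.f⟩

lemma Presentation.exists_map_eq {F : C ⥤ AddCommGrpCat.{v}} (p : Presentation F) {A : C}
    (z : F.obj A) : ∃ a : p.X ⟶ A, F.map a p.gen = z := by
  obtain ⟨a, ha⟩ := p.surjective A z
  exact ⟨a, (p.ε_apply a).symm.trans ha⟩

lemma Presentation.exists_factor {F : C ⥤ AddCommGrpCat.{v}} (p : Presentation F) {A : C}
    (a : p.X ⟶ A) (h : F.map a p.gen = 0) : ∃ b : p.Y ⟶ A, p.f ≫ b = a :=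
  (p.exact A a).1 ((p.ε_apply a).trans h)

lemma Presentation.additive {F : C ⥤ AddCommGrpCat.{v}} (p : Presentation F) : F.Additive where
  map_add {A B f g} := by
    ext z
    obtain ⟨c, rfl⟩ := p.exists_map_eq z
    have e : ∀ k : A ⟶ B, F.map k (F.map c p.gen) = p.ε.app B (c ≫ k) := by
      intro k
      rw [p.ε_apply, Functor.map_comp, ConcreteCategory.comp_apply]
    have e2 : p.ε.app B (c ≫ (f + g)) = p.ε.app B (c ≫ f) + p.ε.app B (c ≫ g) := by
      rw [Preadditive.comp_add]
      exact map_add (p.ε.app B).hom (c ≫ f) (c ≫ g)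
    rw [e, e2, ← e, ← e]
    rfl

/-- `a : X_F ⟶ X_G` lifts `α : G ⟶ F` along the chosen presentations, that is, the square with
sides `(a, -)`, `α` and the two maps `ε` commutes. -/
def IsLift {F G : Fp C} (α : G ⟶ F) (a : F.pres.X ⟶ G.pres.X) : Prop :=
  F.obj.map a F.pres.gen = α.hom.app _ G.pres.gen

lemma exists_isLift {F G : Fp C} (α : G ⟶ F) : ∃ a, IsLift α a := F.pres.exists_map_eq _

lemma IsLift.exists_comm {F G : Fp C} {α : G ⟶ F} {a : F.pres.X ⟶ G.pres.X} (h : IsLift α a) :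
    ∃ b : F.pres.Y ⟶ G.pres.Y, F.pres.f ≫ b = a ≫ G.pres.f := by
  apply F.pres.exists_factor
  have h1 := ConcreteCategory.congr_hom (α.hom.naturality G.pres.f) G.pres.gen
  have h2 : α.hom.app _ (G.obj.map G.pres.f G.pres.gen) =
    F.obj.map G.pres.f (α.hom.app _ G.pres.gen) := h1
  rw [G.pres.map_f_gen, map_zero] at h2
  rw [Functor.map_comp, ConcreteCategory.comp_apply, h, ← h2]

variable {E : Type u'} [Category.{v'} E] [Preadditive E] [HasKernels E]
variable (S : C ⥤ E)

lemma IsLift.kernel_comp {F G : Fp C} {α : G ⟶ F} {a : F.pres.X ⟶ G.pres.X} (h : IsLift α a) :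
    (kernel.ι (S.map F.pres.f) ≫ S.map a) ≫ S.map G.pres.f = 0 := by
  obtain ⟨b, hb⟩ := h.exists_comm
  rw [Category.assoc, ← S.map_comp, ← hb, S.map_comp, kernel.condition_assoc, zero_comp]

variable [S.Additive]

lemma IsLift.unique {F G : Fp C} {α : G ⟶ F} {a a' : F.pres.X ⟶ G.pres.X} (h : IsLift α a)
    (h' : IsLift α a') :
    kernel.ι (S.map F.pres.f) ≫ S.map a = kernel.ι (S.map F.pres.f) ≫ S.map a' := by
  have hF : F.obj.Additive := F.pres.additive
  obtain ⟨b, hb⟩ := F.pres.exists_factor (a - a') (by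
    rw [Functor.map_sub]
    have : (F.obj.map a - F.obj.map a') F.pres.gen =
      F.obj.map a F.pres.gen - F.obj.map a' F.pres.gen := rfl
    rw [this, h, h', sub_self])
  rw [← sub_eq_zero, ← Preadditive.comp_sub, ← S.map_sub, ← hb, S.map_comp,
    kernel.condition_assoc, zero_comp]

lemma IsLift.id (F : Fp C) : IsLift (𝟙 F) (𝟙 F.pres.X) := by
  simp [IsLift]

lemma IsLift.comp {F G H : Fp C} {α : G ⟶ F} {β : H ⟶ G} {a : F.pres.X ⟶ G.pres.X}
    {b : G.pres.X ⟶ H.pres.X} (ha : IsLift α a) (hb : IsLift β b) :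
    IsLift (β ≫ α) (a ≫ b) := by
  have h1 := ConcreteCategory.congr_hom (α.hom.naturality b) G.pres.gen
  have h2 : α.hom.app _ (G.obj.map b G.pres.gen) = F.obj.map b (α.hom.app _ G.pres.gen) := h1
  unfold IsLift at *
  rw [Functor.map_comp, ConcreteCategory.comp_apply, ha, ← h2, hb]
  rfl

lemma IsLift.add {F G : Fp C} {α β : G ⟶ F} {a b : F.pres.X ⟶ G.pres.X} (ha : IsLift α a)
    (hb : IsLift β b) : IsLift (α + β) (a + b) := by
  unfold IsLift at *
  rw [← F.pres.ε_apply]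
  have e : F.pres.ε.app G.pres.X (a + b) =
      F.pres.ε.app G.pres.X a + F.pres.ε.app G.pres.X b :=
    map_add (F.pres.ε.app G.pres.X).hom a b
  rw [e, F.pres.ε_apply, F.pres.ε_apply, ha, hb]
  rfl

/-- For an additive functor `S` on `C`, the contravariant functor on `fp(C, Ab)` sending `F` with
presentation `(Y, -) ⟶ (X, -) ⟶ F ⟶ 0`, the first map being `(f, -)`, to the kernel of
`S f : S X ⟶ S Y`; morphisms are lifted to presentations. -/
def kerPres : (Fp C)ᵒᵖ ⥤ E where
  obj F := kernel (S.map F.unop.pres.f)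
  map {F G} α := kernel.lift _ (kernel.ι (S.map F.unop.pres.f) ≫
    S.map (exists_isLift α.unop).choose) ((exists_isLift α.unop).choose_spec.kernel_comp S)
  map_id F := by
    rw [← cancel_mono (kernel.ι _), kernel.lift_ι, Category.id_comp]
    refine ((exists_isLift _).choose_spec.unique S (IsLift.id F.unop)).trans ?_
    rw [S.map_id, Category.comp_id]
  map_comp {F G H} α β := by
    rw [← cancel_mono (kernel.ι _), kernel.lift_ι, Category.assoc, kernel.lift_ι,
      kernel.lift_ι_assoc, Category.assoc, ← S.map_comp]
    exact (exists_isLift (α ≫ β).unop).choose_spec.unique S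
      ((exists_isLift α.unop).choose_spec.comp (exists_isLift β.unop).choose_spec)

/-- The inclusion of the kernel defining `kerPres S` into `S X`. -/
def kerPresι (F : (Fp C)ᵒᵖ) : (kerPres S).obj F ⟶ S.obj F.unop.pres.X :=
  kernel.ι (S.map F.unop.pres.f)

instance (F : (Fp C)ᵒᵖ) : Mono (kerPresι S F) :=
  inferInstanceAs (Mono (kernel.ι (S.map F.unop.pres.f)))

lemma kerPres_map_ι {F G : (Fp C)ᵒᵖ} (α : F ⟶ G) {a : F.unop.pres.X ⟶ G.unop.pres.X}
    (h : IsLift α.unop a) : (kerPres S).map α ≫ kerPresι S G = kerPresι S F ≫ S.map a :=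
  (kernel.lift_ι _ _ _).trans ((exists_isLift α.unop).choose_spec.unique S h)

instance : (kerPres S).Additive where
  map_add {F G α β} := by
    obtain ⟨a, ha⟩ := exists_isLift α.unop
    obtain ⟨b, hb⟩ := exists_isLift β.unop
    rw [← cancel_mono (kerPresι S G), Preadditive.add_comp, kerPres_map_ι S α ha,
      kerPres_map_ι S β hb, kerPres_map_ι S (α + β) (ha.add hb), S.map_add,
      Preadditive.comp_add]

variable (C) in
lemma isFp_representable [HasZeroObject C] (X : Cᵒᵖ) : isFp C (preadditiveCoyoneda.obj X) := by
  open ZeroObject in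
  refine ⟨⟨(0 : X.unop ⟶ 0), 𝟙 _, fun A => fun a => ⟨fun h => ?_, ?_⟩, fun A a => ⟨a, rfl⟩⟩⟩
  · have h' : a = 0 := h
    exact ⟨(0 : (0 : C) ⟶ A), by rw [h']; exact comp_zero⟩
  · rintro ⟨b, rfl⟩
    exact zero_comp (f := b)

variable (C) in
/-- The contravariant Yoneda embedding `X ↦ (X, -)` into `fp(C, Ab)`. -/
def Y [HasZeroObject C] : Cᵒᵖ ⥤ Fp C := (isFp C).lift preadditiveCoyoneda (isFp_representable C)

instance [HasZeroObject C] : (Y C).Additive where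
  map_add {X X' f g} := by
    ext A z
    exact Preadditive.add_comp _ _ _ f.unop g.unop z

/-- The functor `w` on `fp(C, Ab)`: from `(Y, -) ⟶ (X, -) ⟶ F ⟶ 0` one obtains the exact sequence
`0 ⟶ w F ⟶ X ⟶ Y`. -/
def defect [HasKernels C] : (Fp C)ᵒᵖ ⥤ C := kerPres (𝟭 C)

instance [HasKernels C] : (defect (C := C)).Additive :=
  inferInstanceAs (kerPres (𝟭 C)).Additive

instance [HasZeroObject C] (T : (Fp C)ᵒᵖ ⥤ E) [T.Additive] : ((Y C).rightOp ⋙ T).Additive where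
  map_add {X X' f g} := by
    have h : (Y C).rightOp.map (f + g) = (Y C).rightOp.map f + (Y C).rightOp.map g := by
      apply Quiver.Hom.unop_inj
      exact (Y C).map_add (f := f.op) (g := g.op)
    rw [Functor.comp_map, h, T.map_add]
    rfl

/-- The zeroth derived functor `R₀ T` of an additive contravariant functor `T` on `fp(C, Ab)`,
computed by projective resolutions: if `(Y, -) ⟶ (X, -) ⟶ F ⟶ 0` is exact then `(R₀ T) F` is the
kernel of `T (X, -) ⟶ T (Y, -)`. -/
def rightDerivedZero [HasZeroObject C] (T : (Fp C)ᵒᵖ ⥤ E) [T.Additive] : (Fp C)ᵒᵖ ⥤ E :=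
  kerPres ((Y C).rightOp ⋙ T)

end FinitelyPresented

/-! ## Tensor products over a not necessarily commutative ring -/

section Tensor

variable (R : Type u) [Ring R]

/-- The category `Mod(R)` of right `R`-modules. -/
abbrev RMod := ModuleCat.{u} Rᵐᵒᵖ

/-- The category `mod(Rᵒᵖ)` of finitely presented left `R`-modules. -/
abbrev LfpMod := ObjectProperty.FullSubcategory
  (fun L : ModuleCat.{u} R => Module.FinitePresentation R L)

/-- The category `(mod(Rᵒᵖ), Ab)` of additive functors. -/
abbrev LFun := LfpMod R ⥤+ AddCommGrpCat.{u}

variable {R}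

/-- The relations `m r ⊗ l = m ⊗ r l`. -/
def tensorRel (M : RMod R) (L : ModuleCat.{u} R) : AddSubgroup (M ⊗[ℤ] L) :=
  AddSubgroup.closure
    {t | ∃ (m : M) (r : R) (l : L), t = (MulOpposite.op r • m) ⊗ₜ[ℤ] l - m ⊗ₜ[ℤ] (r • l)}

/-- The tensor product `M ⊗_R L` of a right module and a left module. -/
abbrev Tensor (M : RMod R) (L : ModuleCat.{u} R) : Type u := (M ⊗[ℤ] L) ⧸ tensorRel M L

/-- The map `f ⊗ g : M ⊗_R L → M' ⊗_R L'`. -/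
def Tensor.map {M M' : RMod R} {L L' : ModuleCat.{u} R} (f : M ⟶ M') (g : L ⟶ L') :
    Tensor M L →+ Tensor M' L' :=
  QuotientAddGroup.map _ _
    (TensorProduct.map f.hom.toAddMonoidHom.toIntLinearMap
      g.hom.toAddMonoidHom.toIntLinearMap).toAddMonoidHom (by
    rw [tensorRel, AddSubgroup.closure_le]
    rintro _ ⟨m, r, l, rfl⟩
    refine AddSubgroup.subset_closure ⟨f m, r, g l, ?_⟩
    simp)

/-- The class of `m ⊗ l` in `M ⊗_R L`. -/
def Tensor.tmul {M : RMod R} {L : ModuleCat.{u} R} (m : M) (l : L) : Tensor M L :=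
  QuotientAddGroup.mk (m ⊗ₜ[ℤ] l)

lemma Tensor.map_tmul {M M' : RMod R} {L L' : ModuleCat.{u} R} (f : M ⟶ M') (g : L ⟶ L')
    (m : M) (l : L) : Tensor.map f g (Tensor.tmul m l) = Tensor.tmul (f m) (g l) := rfl

lemma Tensor.add_tmul {M : RMod R} {L : ModuleCat.{u} R} (m m' : M) (l : L) :
    Tensor.tmul (m + m') l = Tensor.tmul m l + Tensor.tmul m' l :=
  congrArg QuotientAddGroup.mk (TensorProduct.add_tmul m m' l)

lemma Tensor.tmul_add {M : RMod R} {L : ModuleCat.{u} R} (m : M) (l l' : L) :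
    Tensor.tmul m (l + l') = Tensor.tmul m l + Tensor.tmul m l' :=
  congrArg QuotientAddGroup.mk (TensorProduct.tmul_add m l l')

lemma Tensor.hom_ext {M : RMod R} {L : ModuleCat.{u} R} {A : Type*} [AddCommGroup A]
    {φ ψ : Tensor M L →+ A} (h : ∀ m l, φ (Tensor.tmul m l) = ψ (Tensor.tmul m l)) : φ = ψ := by
  ext t
  induction t using TensorProduct.induction_on with
  | zero => simp
  | tmul m l => exact h m l
  | add x y hx hy =>
    rw [map_add, map_add, hx, hy]

/-- The functor `M ⊗_R - : mod(Rᵒᵖ) ⥤ Ab`. -/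
def tensorObj (M : RMod R) : LfpMod R ⥤ AddCommGrpCat.{u} where
  obj L := AddCommGrpCat.of (Tensor M L.obj)
  map g := AddCommGrpCat.ofHom (Tensor.map (𝟙 M) g.hom)
  map_id _ := AddCommGrpCat.hom_ext (Tensor.hom_ext fun _ _ => rfl)
  map_comp _ _ := AddCommGrpCat.hom_ext (Tensor.hom_ext fun _ _ => rfl)

instance (M : RMod R) : (tensorObj M).Additive where
  map_add {_ _ g h} := AddCommGrpCat.hom_ext (Tensor.hom_ext fun m l =>
    Tensor.tmul_add m (g.hom l) (h.hom l))

variable (R) in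
/-- The tensor embedding `t : Mod(R) ⥤ (mod(Rᵒᵖ), Ab)`, `t M = M ⊗_R -`. -/
def t : RMod R ⥤ LFun R where
  obj M := AdditiveFunctor.of (tensorObj M)
  map f := ObjectProperty.homMk
    { app L := AddCommGrpCat.ofHom (Tensor.map f (𝟙 L.obj))
      naturality _ _ _ := AddCommGrpCat.hom_ext (Tensor.hom_ext fun _ _ => rfl) }
  map_id M := by
    ext L : 3
    exact AddCommGrpCat.hom_ext (Tensor.hom_ext fun _ _ => rfl)
  map_comp f g := by
    ext L : 3
    exact AddCommGrpCat.hom_ext (Tensor.hom_ext fun _ _ => rfl)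

instance : (t R).Additive where
  map_add {_ _ f g} := by
    ext L : 3
    exact AddCommGrpCat.hom_ext (Tensor.hom_ext fun m l => Tensor.add_tmul (f m) (g m) l)

end Tensor

/-! ## The functors `D_A` and `D_R` -/

section Functors

variable (R : Type u) [Ring R]

instance : (additiveFunctor (LfpMod R) AddCommGrpCat.{u}).IsClosedUnderSubobjects where
  prop_of_mono {F G} i hi hG := by
    have : G.Additive := hG
    constructor
    intro L L' f g
    rw [← cancel_mono (i.app L'), Preadditive.add_comp, i.naturality, i.naturality, i.naturality,
      G.map_add, Preadditive.comp_add]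

/-- The Auslander-Gruson-Jensen functor `D_A = R₀(t ∘ w)`, a contravariant functor from
`fp(Mod(R), Ab)` to `(mod(Rᵒᵖ), Ab)`. -/
def DA : (Fp (RMod R))ᵒᵖ ⥤ LFun R := rightDerivedZero (defect ⋙ t R)

lemma lfp_le_isFG : (fun L : ModuleCat.{u} R => Module.FinitePresentation R L) ≤
    ModuleCat.isFG R := fun L (_ : Module.FinitePresentation R L) =>
  (inferInstance : Module.Finite R L)

instance : EssentiallySmall.{u} (LfpMod R) :=
  have := (ObjectProperty.fullyFaithfulιOfLE (lfp_le_isFG R)).full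
  have := (ObjectProperty.fullyFaithfulιOfLE (lfp_le_isFG R)).faithful
  have : EssentiallySmall.{u} (ModuleCat.isFG.{u} R).FullSubcategory :=
    inferInstanceAs (EssentiallySmall.{u} (FGModuleCat.{u} R))
  essentiallySmall_of_fully_faithful (ObjectProperty.ιOfLE (lfp_le_isFG R))

instance : LocallySmall.{u} (LFun R) where
  hom_small F G := by
    let e := (equivSmallModel.{u} (LfpMod R)).inverse
    have h : Small.{u} (e ⋙ F.obj ⟶ e ⋙ G.obj) := inferInstance
    refine small_of_injective (f := fun α : F ⟶ G => Functor.whiskerLeft e α.hom) ?_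
    intro α β hαβ
    apply ObjectProperty.hom_ext
    exact ((Functor.whiskeringLeft _ _ AddCommGrpCat.{u}).obj e).map_injective hαβ

variable {A : Type u'} [Category.{v'} A] [Preadditive A] [LocallySmall.{w} A]

/-- The abelian group of morphisms `G ⟶ H` in a locally small preadditive category, moved to the
small universe along `equivShrink`. -/
def shrinkHom (G H : A) : AddCommGrpCat.{w} := AddCommGrpCat.of (Shrink.{w} (G ⟶ H))

/-- The identification of `shrinkHom G H` with the group of morphisms `G ⟶ H`. -/
def shrinkHomEquiv (G H : A) : (G ⟶ H) ≃+ shrinkHom.{w} G H :=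
  (equivShrink (G ⟶ H)).symm.addEquiv.symm

/-- Postcomposition with `φ`. -/
def shrinkHomPost (G : A) {H H' : A} (φ : H ⟶ H') : shrinkHom.{w} G H ⟶ shrinkHom.{w} G H' :=
  AddCommGrpCat.ofHom ((shrinkHomEquiv G H').toAddMonoidHom.comp
    ((Preadditive.rightComp G φ).comp (shrinkHomEquiv G H).symm.toAddMonoidHom))

/-- Precomposition with `γ`. -/
def shrinkHomPre {G G' : A} (γ : G' ⟶ G) (H : A) : shrinkHom.{w} G H ⟶ shrinkHom.{w} G' H :=
  AddCommGrpCat.ofHom ((shrinkHomEquiv G' H).toAddMonoidHom.comp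
    ((Preadditive.leftComp H γ).comp (shrinkHomEquiv G H).symm.toAddMonoidHom))

lemma shrinkHomPost_apply (G : A) {H H' : A} (φ : H ⟶ H') (x : shrinkHom.{w} G H) :
    shrinkHomPost G φ x = shrinkHomEquiv G H' ((shrinkHomEquiv G H).symm x ≫ φ) := rfl

lemma shrinkHomPre_apply {G G' : A} (γ : G' ⟶ G) (H : A) (x : shrinkHom.{w} G H) :
    shrinkHomPre γ H x = shrinkHomEquiv G' H (γ ≫ (shrinkHomEquiv G H).symm x) := rfl

variable (A) in
/-- The bifunctor `(G, H) ↦ Hom(G, H)` with values in small abelian groups. -/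
def shrinkHomFunctor : Aᵒᵖ ⥤ A ⥤ AddCommGrpCat.{w} where
  obj G :=
    { obj H := shrinkHom G.unop H
      map φ := shrinkHomPost G.unop φ
      map_id H := by ext x; simp [shrinkHomPost_apply]
      map_comp φ ψ := by ext x; simp [shrinkHomPost_apply] }
  map γ :=
    { app H := shrinkHomPre γ.unop H
      naturality H H' φ := by ext x; simp [shrinkHomPost_apply, shrinkHomPre_apply] }
  map_id G := by ext H x; simp [shrinkHomPre_apply]
  map_comp γ δ := by ext H x; simp [shrinkHomPre_apply]

/-- The functor `D_R`, contravariant in `G`, given by `(D_R G)(X) = Nat(G, X ⊗ -)`, with values in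
all functors `Mod(R) ⥤ Ab`. -/
def preDR : (LFun R)ᵒᵖ ⥤ (RMod R ⥤ AddCommGrpCat.{u}) :=
  shrinkHomFunctor (LFun R) ⋙ (Functor.whiskeringLeft _ _ _).obj (t R)

/-- The functor `D_R` with values in `fp(Mod(R), Ab)`, given that its values are finitely
presented. -/
def DR (h : ∀ G : (LFun R)ᵒᵖ, isFp (RMod R) ((preDR R).obj G)) : (LFun R)ᵒᵖ ⥤ Fp (RMod R) :=
  (isFp (RMod R)).lift (preDR R) h

end Functors

end AGJ

end

noncomputable section

namespace AGJ

/-! ## Presentations and finitely presented functors -/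

section Presentations

variable {C : Type u} [Category.{v} C] [Preadditive C]

/-! Adjunction. Let `f : X ⟶ Y` present `F`. Since `w (X, -) ≅ X` naturally, `D_A F` is the kernel
of `X ⊗ - ⟶ Y ⊗ -` (`DAIso`). A morphism `G ⟶ D_A F` is therefore an element of `Nat(G, X ⊗ -) =
(D_R G)(X)` killed by `f`, and by Yoneda such elements are the transformations `F ⟶ D_R G`
(`homKerPresEquiv`).

Finite presentation. A transformation `G ⟶ M ⊗ -` is a family of elements of the groups `M ⊗ L`,
indexed by the elements of `G` over a small model of `mod(Rᵒᵖ)`, subject to conditions valued in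
further groups `M ⊗ L`. So `D_R G` is the kernel of a map between products of functors `- ⊗ L`.
These are finitely presented because `L` is (`isFp_tensorWith`), and finitely presented functors are
closed under products and kernels (`isFp_piFunctor`, `isFp_of_kernel`), as right modules have
coproducts and pushouts.

Full faithfulness amounts to the counit being invertible. If `f : X ⟶ Y` presents `D_R G`, its
generator is a morphism `γ : G ⟶ X ⊗ -`, and `0 ⟶ G ⟶ X ⊗ - ⟶ Y ⊗ -` has to be exact
(`gen_injective_and_exact`). For a finitely presented left module `N` with character module `N*`,
the isomorphism `N* ⊗ M ≅ Hom(M, N)*` (`dualEv_bijective`) turns characters of `H N` into morphisms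
`H ⟶ N* ⊗ -`. Hence there are enough morphisms to functors `N* ⊗ -` to detect nonzero elements and
elements outside an image. Those out of `G` factor through `γ`; those out of `X ⊗ -` come from
module homomorphisms because `t` is full, and they factor through `f` if they kill `γ`. -/

omit [Preadditive C] in
lemma nat_apply {F H : C ⥤ AddCommGrpCat.{v}} (α : F ⟶ H) {A B : C} (a : A ⟶ B) (z : F.obj A) :
    α.app B (F.map a z) = H.map a (α.app A z) :=
  ConcreteCategory.congr_hom (α.naturality a) z

omit [Preadditive C] in
lemma map_comp_apply' (F : C ⥤ AddCommGrpCat.{v}) {A B D : C} (a : A ⟶ B) (b : B ⟶ D)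
    (z : F.obj A) : F.map (a ≫ b) z = F.map b (F.map a z) := by
  rw [F.map_comp, ConcreteCategory.comp_apply]

lemma map_add_apply' (F : C ⥤ AddCommGrpCat.{v}) [F.Additive] {A B : C} (a b : A ⟶ B)
    (z : F.obj A) : F.map (a + b) z = F.map a z + F.map b z := by
  rw [F.map_add]; rfl

lemma map_sub_apply' (F : C ⥤ AddCommGrpCat.{v}) [F.Additive] {A B : C} (a b : A ⟶ B)
    (z : F.obj A) : F.map (a - b) z = F.map a z - F.map b z := by
  rw [F.map_sub]; rfl

namespace Presentation

variable {F H : C ⥤ AddCommGrpCat.{v}} (p : Presentation F)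

lemma map_gen_eq_zero_iff {A : C} (a : p.X ⟶ A) :
    F.map a p.gen = 0 ↔ ∃ b : p.Y ⟶ A, p.f ≫ b = a := by
  refine ⟨p.exists_factor a, ?_⟩
  rintro ⟨b, rfl⟩
  rw [map_comp_apply', p.map_f_gen, map_zero]

lemma hom_ext {α β : F ⟶ H} (h : α.app _ p.gen = β.app _ p.gen) : α = β := by
  ext A z
  obtain ⟨a, rfl⟩ := p.exists_map_eq z
  rw [nat_apply, nat_apply, h]

/-- The difference `a - a'` kills the generator, so it factors through `p.f`, which kills `z`. This
makes the transformation in `exists_desc` independent of choices. -/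
lemma map_eq_of_map_gen_eq [H.Additive] (z : H.obj p.X) (hz : H.map p.f z = 0) {A : C}
    {a a' : p.X ⟶ A} (h : F.map a p.gen = F.map a' p.gen) : H.map a z = H.map a' z := by
  have := p.additive
  obtain ⟨b, hb⟩ := p.exists_factor (a - a') (by rw [map_sub_apply', h, sub_self])
  rw [← sub_eq_zero, ← map_sub_apply', ← hb, map_comp_apply', hz, map_zero]

/-- The Yoneda lemma for a presented functor: the transformation has to send `F.map a p.gen` to
`H.map a z`, and this is well defined. -/
lemma exists_desc [H.Additive] (z : H.obj p.X) (hz : H.map p.f z = 0) :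
    ∃ α : F ⟶ H, α.app _ p.gen = z := by
  have := p.additive
  have key {A : C} (a : p.X ⟶ A) :
      H.map (p.exists_map_eq (F.map a p.gen)).choose z = H.map a z :=
    p.map_eq_of_map_gen_eq z hz (p.exists_map_eq _).choose_spec
  refine ⟨{ app A := AddCommGrpCat.ofHom (AddMonoidHom.mk'
              (fun y => H.map (p.exists_map_eq y).choose z) ?_)
            naturality A B g := ?_ }, ?_⟩
  · intro y y'
    obtain ⟨a, rfl⟩ := p.exists_map_eq y
    obtain ⟨a', rfl⟩ := p.exists_map_eq y'
    rw [← map_add_apply', key, key, key, map_add_apply']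
  · ext y
    obtain ⟨a, rfl⟩ := p.exists_map_eq y
    change H.map (p.exists_map_eq (F.map g (F.map a p.gen))).choose z =
      H.map g (H.map (p.exists_map_eq (F.map a p.gen)).choose z)
    rw [← map_comp_apply', key, key, map_comp_apply']
  · have h := key (𝟙 p.X)
    rw [F.map_id, H.map_id] at h
    exact h

end Presentation

/-- A functor is finitely presented if it has a generator whose relations are those generated by
one morphism. -/
lemma isFp_of_generator (F : C ⥤ AddCommGrpCat.{v}) [F.Additive] {X Y : C} (f : X ⟶ Y)
    (z : F.obj X) (hs : ∀ (A : C) (y : F.obj A), ∃ a : X ⟶ A, F.map a z = y)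
    (hr : ∀ (A : C) (a : X ⟶ A), F.map a z = 0 ↔ ∃ b : Y ⟶ A, f ≫ b = a) : isFp C F :=
  ⟨{ X := X
     Y := Y
     f := f
     ε :=
      { app A := AddCommGrpCat.ofHom (AddMonoidHom.mk' (fun a : X ⟶ A => F.map a z)
          (fun a b => map_add_apply' F a b z))
        naturality A B g := by
          ext a
          exact map_comp_apply' F a g z }
     exact := hr
     surjective := hs }⟩

/-- Lift `φ` to `l : p'.X ⟶ p.X`. The class of `a : p.X ⟶ A` lies in the kernel iff `l ≫ a` factors
through `p'.f`, that is, iff `a` extends to the pushout of `l` and `p'.f`; so this pushout carries a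
generator of `K`. A morphism `c` out of it gives zero iff its restriction to `p.X` factors through
`p.f`, that is, iff `c` extends to a second pushout. -/
lemma isFp_of_kernel [HasPushouts C] {K F F' : C ⥤ AddCommGrpCat.{v}} [K.Additive]
    (hF : isFp C F) (hF' : isFp C F') (ι : K ⟶ F) (φ : F ⟶ F')
    (hι : ∀ A, Function.Injective (ι.app A))
    (hφ : ∀ A, Function.Exact (ι.app A) (φ.app A)) : isFp C K := by
  obtain ⟨p⟩ := hF
  obtain ⟨p'⟩ := hF'
  obtain ⟨l, hl⟩ := p'.exists_map_eq (φ.app _ p.gen)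
  have hφa {A : C} (a : p.X ⟶ A) : φ.app A (F.map a p.gen) = F'.map (l ≫ a) p'.gen := by
    rw [nat_apply, ← hl, map_comp_apply']
  obtain ⟨k, hk⟩ := (hφ _ (F.map (pushout.inl l p'.f) p.gen)).1 (by
    rw [hφa, pushout.condition, map_comp_apply', p'.map_f_gen, map_zero])
  have hιk {A : C} (c : pushout l p'.f ⟶ A) :
      ι.app A (K.map c k) = F.map (pushout.inl l p'.f ≫ c) p.gen := by
    rw [nat_apply, hk, map_comp_apply']
  refine isFp_of_generator K (pushout.inl (pushout.inl l p'.f) p.f) k (fun A y => ?_)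
    (fun A c => ?_)
  · obtain ⟨a, ha⟩ := p.exists_map_eq (ι.app A y)
    obtain ⟨b, hb⟩ := p'.exists_factor (l ≫ a) (by
      rw [← hφa, ha]; exact (hφ _ _).2 ⟨y, rfl⟩)
    refine ⟨pushout.desc a b hb.symm, hι A ?_⟩
    rw [hιk, pushout.inl_desc, ha]
  · rw [← map_eq_zero_iff (ι.app A).hom (hι A)]
    change ι.app A (K.map c k) = 0 ↔ _
    rw [hιk, p.map_gen_eq_zero_iff]
    constructor
    · rintro ⟨b, hb⟩
      exact ⟨pushout.desc c b hb.symm, pushout.inl_desc _ _ _⟩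
    · rintro ⟨d, rfl⟩
      exact ⟨pushout.inr _ _ ≫ d, by rw [← pushout.condition_assoc]⟩

/-- The product of a family of functors with values in abelian groups. -/
def piFunctor {I : Type v} (F : I → C ⥤ AddCommGrpCat.{v}) : C ⥤ AddCommGrpCat.{v} where
  obj A := AddCommGrpCat.of (∀ i, (F i).obj A)
  map a := AddCommGrpCat.ofHom
    (AddMonoidHom.mk' (fun z i => (F i).map a (z i)) fun z z' => by ext i; exact map_add _ _ _)
  map_id A := by
    refine AddCommGrpCat.hom_ext (AddMonoidHom.ext fun z => funext fun i => ?_)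
    exact ConcreteCategory.congr_hom ((F i).map_id A) (z i)
  map_comp a b := by
    refine AddCommGrpCat.hom_ext (AddMonoidHom.ext fun z => funext fun i => ?_)
    exact map_comp_apply' (F i) a b (z i)

instance {I : Type v} (F : I → C ⥤ AddCommGrpCat.{v}) [∀ i, (F i).Additive] :
    (piFunctor F).Additive where
  map_add {A B a b} := by
    refine AddCommGrpCat.hom_ext (AddMonoidHom.ext fun z => funext fun i => ?_)
    exact map_add_apply' (F i) a b (z i)

/-- Morphisms out of a coproduct are families of morphisms, so the coproduct of the presenting
morphisms presents the product. -/
lemma isFp_piFunctor [HasCoproducts.{v} C] {I : Type v} (F : I → C ⥤ AddCommGrpCat.{v})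
    (hF : ∀ i, isFp C (F i)) : isFp C (piFunctor F) := by
  have p (i : I) : Presentation (F i) := (hF i).some
  have hadd (i : I) : (F i).Additive := (p i).additive
  refine isFp_of_generator _ (Limits.Sigma.map fun i => (p i).f)
    (fun i => (F i).map (Sigma.ι (fun i => (p i).X) i) (p i).gen) (fun A y => ?_) fun A a => ?_
  · choose a ha using fun i => (p i).exists_map_eq (y i)
    refine ⟨Sigma.desc a, ?_⟩
    funext i
    change (F i).map _ ((F i).map _ _) = _
    rw [← map_comp_apply', Sigma.ι_desc, ha]
  · have h : (piFunctor F).map a (fun i => (F i).map (Sigma.ι (fun i => (p i).X) i) (p i).gen) = 0 ↔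
        ∀ i, (F i).map (Sigma.ι (fun i => (p i).X) i ≫ a) (p i).gen = 0 := by
      simp only [map_comp_apply']
      exact funext_iff
    rw [h]
    simp only [Presentation.map_gen_eq_zero_iff]
    constructor
    · intro hb
      choose b hb using hb
      refine ⟨Sigma.desc b, Sigma.hom_ext _ _ fun i => ?_⟩
      rw [Sigma.ι_map_assoc, Sigma.ι_desc, hb]
    · rintro ⟨b, rfl⟩ i
      exact ⟨Sigma.ι (fun i => (p i).Y) i ≫ b, by rw [Sigma.ι_map_assoc]⟩

end Presentations

/-! ## The adjunction between `kerPres` and the restricted hom functor -/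

section Adjunction

variable {C : Type u} [Category.{v} C] [Preadditive C]

/-- The generator of a presentation of `(X, -)`, as a morphism. -/
def Presentation.genHom {X : C} (p : Presentation (preadditiveCoyoneda.obj (op X))) : X ⟶ p.X :=
  p.gen

namespace Presentation

variable {X : C} (p : Presentation (preadditiveCoyoneda.obj (op X)))

lemma genHom_f : p.genHom ≫ p.f = 0 := p.map_f_gen

lemma exists_genHom_comp {A : C} (a : X ⟶ A) : ∃ s : p.X ⟶ A, p.genHom ≫ s = a :=
  p.exists_map_eq a

lemma exists_f_comp {A : C} (a : p.X ⟶ A) (h : p.genHom ≫ a = 0) : ∃ b, p.f ≫ b = a :=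
  p.exists_factor a h

/-- The complex `X ⟶ p.X ⟶ p.Y` is split: surjectivity at `X` gives a retraction `s` of `p.genHom`,
and exactness makes `𝟙 - s ≫ p.genHom` factor through `p.f`. So `p.genHom` is a kernel of `p.f`. -/
lemma isIso_of_kernel {K : C} (k : K ⟶ p.X) [Mono k] (hk : k ≫ p.f = 0) (j : X ⟶ K)
    (hj : j ≫ k = p.genHom) : IsIso j := by
  obtain ⟨s, hs⟩ := p.exists_genHom_comp (𝟙 X)
  obtain ⟨b, hb⟩ := p.exists_f_comp (𝟙 p.X - s ≫ p.genHom) (by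
    rw [Preadditive.comp_sub, reassoc_of% hs, Category.comp_id, sub_self])
  refine ⟨k ≫ s, ?_, ?_⟩
  · rw [reassoc_of% hj, hs]
  · rw [← cancel_mono k, Category.assoc, Category.assoc, hj, Category.id_comp]
    have h : k ≫ (𝟙 p.X - s ≫ p.genHom) = 0 := by
      rw [← hb, reassoc_of% hk, zero_comp]
    rw [Preadditive.comp_sub, Category.comp_id, sub_eq_zero] at h
    exact h.symm

end Presentation

section Defect

variable [HasKernels C] [HasZeroObject C]

/-- The chosen presentation of `(X, -)`. -/
def presY (X : C) : Presentation (preadditiveCoyoneda.obj (op X)) := ((Y C).obj (op X)).pres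

/-- The inclusion of `w (X, -)`. -/
def defectYι (X : C) : (defect (C := C)).obj ((Y C).rightOp.obj X) ⟶ (presY X).X :=
  kerPresι (𝟭 C) ((Y C).rightOp.obj X)

instance (X : C) : Mono (defectYι X) :=
  inferInstanceAs (Mono (kerPresι (𝟭 C) ((Y C).rightOp.obj X)))

/-- The morphism `X ⟶ w (X, -)`. -/
def toDefectY (X : C) : X ⟶ (defect (C := C)).obj ((Y C).rightOp.obj X) :=
  kernel.lift (presY X).f (presY X).genHom (presY X).genHom_f

lemma toDefectY_ι (X : C) : toDefectY X ≫ defectYι X = (presY X).genHom :=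
  kernel.lift_ι (presY X).f (presY X).genHom (presY X).genHom_f

instance (X : C) : IsIso (toDefectY X) :=
  (presY X).isIso_of_kernel (defectYι X) (kernel.condition (presY X).f) _ (toDefectY_ι X)

/-- The isomorphism `X ≅ w (X, -)`. -/
def defectYIso (X : C) : X ≅ (defect (C := C)).obj ((Y C).rightOp.obj X) := asIso (toDefectY X)

lemma toDefectY_naturality {X X' : C} (g : X ⟶ X') :
    g ≫ toDefectY X' = toDefectY X ≫ defect.map ((Y C).rightOp.map g) := by
  obtain ⟨a, ha⟩ := exists_isLift ((Y C).rightOp.map g).unop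
  have h : defect.map ((Y C).rightOp.map g) ≫ defectYι X' =
    defectYι X ≫ (show (presY X).X ⟶ (presY X').X from a) := kerPres_map_ι (𝟭 C) _ ha
  have ha' : (presY X).genHom ≫ (show (presY X).X ⟶ (presY X').X from a) =
      g ≫ (presY X').genHom := ha
  rw [← cancel_mono (defectYι X'), Category.assoc, Category.assoc, h, toDefectY_ι,
    reassoc_of% (toDefectY_ι X), ha']

variable (C) in
/-- The functor `X ↦ w (X, -)` is isomorphic to the identity. -/
def YDefectIso : 𝟭 C ≅ (Y C).rightOp ⋙ defect :=
  NatIso.ofComponents defectYIso toDefectY_naturality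

end Defect

variable {E : Type u'} [Category.{v'} E] [Preadditive E] [HasKernels E]

/-- The isomorphism of kernels induced by an isomorphism of functors. -/
def kerPresObjIso {S T : C ⥤ E} [S.Additive] [T.Additive] (e : S ≅ T) (F : (Fp C)ᵒᵖ) :
    (kerPres S).obj F ≅ (kerPres T).obj F :=
  kernel.mapIso _ _ (e.app F.unop.pres.X) (e.app F.unop.pres.Y) (by simp)

lemma kerPresObjIso_hom_ι {S T : C ⥤ E} [S.Additive] [T.Additive] (e : S ≅ T) (F : (Fp C)ᵒᵖ) :
    (kerPresObjIso e F).hom ≫ kerPresι T F = kerPresι S F ≫ e.hom.app _ :=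
  kernel.lift_ι _ _ _

/-- The functor `kerPres` preserves isomorphisms of functors. -/
def kerPresIso {S T : C ⥤ E} [S.Additive] [T.Additive] (e : S ≅ T) : kerPres S ≅ kerPres T :=
  NatIso.ofComponents (kerPresObjIso e) fun {F G} α => by
    obtain ⟨a, ha⟩ := exists_isLift α.unop
    rw [← cancel_mono (kerPresι T G), Category.assoc, Category.assoc, kerPresObjIso_hom_ι,
      kerPres_map_ι T α ha, reassoc_of% (kerPresObjIso_hom_ι e F), ← Category.assoc,
      kerPres_map_ι S α ha]
    simp

variable [LocallySmall.{v} E] (T : C ⥤ E) [T.Additive]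

variable (C) in
/-- The functor sending `G` to `X ↦ Hom(G, T X)`. -/
def restrictedHom : Eᵒᵖ ⥤ (C ⥤ AddCommGrpCat.{v}) :=
  shrinkHomFunctor E ⋙ (Functor.whiskeringLeft _ _ _).obj T

/-- The values of `restrictedHom`. -/
def restrictedHomEquiv (G : Eᵒᵖ) (X : C) :
    (G.unop ⟶ T.obj X) ≃+ ((restrictedHom C T).obj G).obj X :=
  shrinkHomEquiv G.unop (T.obj X)

omit [Preadditive C] [HasKernels E] [T.Additive] in
lemma restrictedHom_map_apply (G : Eᵒᵖ) {X X' : C} (g : X ⟶ X') (φ : G.unop ⟶ T.obj X) :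
    ((restrictedHom C T).obj G).map g (restrictedHomEquiv T G X φ) =
      restrictedHomEquiv T G X' (φ ≫ T.map g) :=
  congrArg (fun ψ => restrictedHomEquiv T G X' (ψ ≫ T.map g))
    ((shrinkHomEquiv G.unop (T.obj X)).symm_apply_apply φ)

omit [Preadditive C] [HasKernels E] [T.Additive] in
lemma restrictedHom_app_apply {G G' : Eᵒᵖ} (γ : G ⟶ G') (X : C) (φ : G.unop ⟶ T.obj X) :
    ((restrictedHom C T).map γ).app X (restrictedHomEquiv T G X φ) =
      restrictedHomEquiv T G' X (γ.unop ≫ φ) :=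
  congrArg (fun ψ => restrictedHomEquiv T G' X (γ.unop ≫ ψ))
    ((shrinkHomEquiv G.unop (T.obj X)).symm_apply_apply φ)

instance (G : Eᵒᵖ) : ((restrictedHom C T).obj G).Additive where
  map_add {X X' a b} := by
    ext z
    obtain ⟨φ, rfl⟩ := (restrictedHomEquiv T G X).surjective z
    refine (restrictedHom_map_apply T G (a + b) φ).trans ?_
    rw [T.map_add, Preadditive.comp_add, map_add, ← restrictedHom_map_apply,
      ← restrictedHom_map_apply]
    rfl

instance : (restrictedHom C T).Additive where
  map_add {G G' a b} := by
    ext X z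
    obtain ⟨φ, rfl⟩ := (restrictedHomEquiv T G X).surjective z
    refine (restrictedHom_app_apply T (a + b) X φ).trans ?_
    rw [unop_add, Preadditive.add_comp, map_add, ← restrictedHom_app_apply,
      ← restrictedHom_app_apply]
    rfl

omit [LocallySmall.{v} E] in
lemma kerPresι_comp (F : Fp C) : kerPresι T (op F) ≫ T.map F.pres.f = 0 := kernel.condition _

omit [LocallySmall.{v} E] in
lemma exists_kerPres_lift {F : Fp C} {G : E} (φ : G ⟶ T.obj F.pres.X)
    (h : φ ≫ T.map F.pres.f = 0) : ∃ ψ : G ⟶ (kerPres T).obj (op F), ψ ≫ kerPresι T (op F) = φ :=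
  ⟨kernel.lift _ φ h, kernel.lift_ι _ _ _⟩

/-- A morphism into the kernel of `T f` is an element of `Hom(G, T X)` killed by `f`, which is
exactly the input of `Presentation.exists_desc`. The next lemma is the converse direction. -/
lemma exists_restrictedHom_desc {F : Fp C} {G : E} (φ : G ⟶ (kerPres T).obj (op F)) :
    ∃ α : F.obj ⟶ (restrictedHom C T).obj (op G),
      α.app _ F.pres.gen = restrictedHomEquiv T (op G) _ (φ ≫ kerPresι T (op F)) := by
  refine F.pres.exists_desc _ ?_
  rw [restrictedHom_map_apply, Category.assoc, kerPresι_comp, comp_zero, map_zero]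

lemma exists_lift_of_restrictedHom {F : Fp C} {G : E}
    (α : F.obj ⟶ (restrictedHom C T).obj (op G)) :
    ∃ φ : G ⟶ (kerPres T).obj (op F),
      restrictedHomEquiv T (op G) _ (φ ≫ kerPresι T (op F)) = α.app _ F.pres.gen := by
  obtain ⟨ψ, hψ⟩ := (restrictedHomEquiv T (op G) F.pres.X).surjective (α.app _ F.pres.gen)
  obtain ⟨φ, hφ⟩ := exists_kerPres_lift T (G := G) ψ (by
    apply (restrictedHomEquiv T (op G) F.pres.Y).injective
    rw [← restrictedHom_map_apply, hψ, ← nat_apply, F.pres.map_f_gen, map_zero, map_zero])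
  exact ⟨φ, by rw [hφ, hψ]⟩

/-- The bijection `Hom(G, ker T f) ≃ Nat(F, Hom(G, T -))`, where `f` is the morphism presenting
`F`. -/
def homKerPresEquiv (F : Fp C) (G : E) :
    (G ⟶ (kerPres T).obj (op F)) ≃ (F.obj ⟶ (restrictedHom C T).obj (op G)) where
  toFun φ := (exists_restrictedHom_desc T φ).choose
  invFun α := (exists_lift_of_restrictedHom T α).choose
  left_inv φ := by
    rw [← cancel_mono (kerPresι T (op F))]
    apply (restrictedHomEquiv T (op G) F.pres.X).injective
    exact (exists_lift_of_restrictedHom T _).choose_spec.trans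
      (exists_restrictedHom_desc T φ).choose_spec
  right_inv α := F.pres.hom_ext <| (exists_restrictedHom_desc T _).choose_spec.trans
    (exists_lift_of_restrictedHom T α).choose_spec

lemma homKerPresEquiv_gen (F : Fp C) (G : E) (φ : G ⟶ (kerPres T).obj (op F)) :
    (homKerPresEquiv T F G φ).app _ F.pres.gen =
      restrictedHomEquiv T (op G) _ (φ ≫ kerPresι T (op F)) :=
  (exists_restrictedHom_desc T φ).choose_spec

lemma homKerPresEquiv_symm_ι (F : Fp C) (G : E) (α : F.obj ⟶ (restrictedHom C T).obj (op G)) :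
    restrictedHomEquiv T (op G) _ ((homKerPresEquiv T F G).symm α ≫ kerPresι T (op F)) =
      α.app _ F.pres.gen :=
  (exists_lift_of_restrictedHom T α).choose_spec

lemma homKerPresEquiv_naturality_left {F F' : Fp C} {G : E} (α : F' ⟶ F)
    (φ : G ⟶ (kerPres T).obj (op F)) :
    homKerPresEquiv T F' G (φ ≫ (kerPres T).map α.op) = α.hom ≫ homKerPresEquiv T F G φ := by
  refine F'.pres.hom_ext ?_
  obtain ⟨a, ha⟩ := exists_isLift α
  have h : (α.hom ≫ homKerPresEquiv T F G φ).app _ F'.pres.gen =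
      (homKerPresEquiv T F G φ).app _ (F.obj.map a F.pres.gen) := by
    rw [show F.obj.map a F.pres.gen = _ from ha]
    rfl
  rw [homKerPresEquiv_gen, h, nat_apply, homKerPresEquiv_gen, Category.assoc,
    kerPres_map_ι T α.op ha, restrictedHom_map_apply, Category.assoc]

lemma homKerPresEquiv_naturality_right {F : Fp C} {G G' : E} (γ : G' ⟶ G)
    (φ : G ⟶ (kerPres T).obj (op F)) :
    homKerPresEquiv T F G' (γ ≫ φ) =
      homKerPresEquiv T F G φ ≫ (restrictedHom C T).map γ.op := by
  refine F.pres.hom_ext ?_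
  have h : (homKerPresEquiv T F G φ ≫ (restrictedHom C T).map γ.op).app _ F.pres.gen =
      ((restrictedHom C T).map γ.op).app _ ((homKerPresEquiv T F G φ).app _ F.pres.gen) := rfl
  rw [homKerPresEquiv_gen, h, homKerPresEquiv_gen, restrictedHom_app_apply, Category.assoc]
  rfl

variable (h : ∀ G, isFp C ((restrictedHom C T).obj G))

/-- If the functors `Hom(G, T -)` are finitely presented, then `G ↦ Hom(G, T -)` is right adjoint
to `kerPres T`. -/
def kerPresAdj : (kerPres T).rightOp ⊣ (isFp C).lift (restrictedHom C T) h :=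
  Adjunction.mkOfHomEquiv
    { homEquiv F G :=
        { toFun φ := ObjectProperty.homMk (homKerPresEquiv T F G.unop φ.unop)
          invFun α := ((homKerPresEquiv T F G.unop).symm α.hom).op
          left_inv φ := by
            apply Quiver.Hom.unop_inj
            exact (homKerPresEquiv T F G.unop).symm_apply_apply φ.unop
          right_inv α := by
            ext1
            exact (homKerPresEquiv T F G.unop).apply_symm_apply α.hom }
      homEquiv_naturality_left_symm {F' F G} α β := by
        apply Quiver.Hom.unop_inj
        change (homKerPresEquiv T F' G.unop).symm (α.hom ≫ β.hom) =
          (homKerPresEquiv T F G.unop).symm β.hom ≫ (kerPres T).map α.op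
        rw [Equiv.symm_apply_eq, homKerPresEquiv_naturality_left, Equiv.apply_symm_apply]
      homEquiv_naturality_right {F G G'} φ γ := by
        ext1
        exact homKerPresEquiv_naturality_right T γ.unop φ.unop }

/-- The functor `Hom(G, T -)` as an object of `fp(C, Ab)`. -/
abbrev restrictedHomFp (G : Eᵒᵖ) : Fp C := ((isFp C).lift (restrictedHom C T) h).obj G

/-- The counit corresponds to the identity of `Hom(G, T -)`, which fixes the generator; so the
counit followed by the kernel inclusion is the generator read as a morphism `G ⟶ T X`. -/
lemma kerPresAdj_counit_ι (G : Eᵒᵖ) :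
    restrictedHomEquiv T G _
      (((kerPresAdj T h).counit.app G).unop ≫ kerPresι T (op (restrictedHomFp T h G))) =
      (restrictedHomFp T h G).pres.gen := by
  rw [← Adjunction.homEquiv_symm_id, kerPresAdj, Adjunction.mkOfHomEquiv_homEquiv]
  exact homKerPresEquiv_symm_ι T (restrictedHomFp T h G) G.unop (𝟙 _)

end Adjunction

/-! ## Tensor products with finitely presented modules -/

section TensorFp

variable {R : Type u} [Ring R]

namespace Tensor

variable {M : RMod R} {L : ModuleCat.{u} R}

lemma smul_tmul (m : M) (r : R) (l : L) : tmul (MulOpposite.op r • m) l = tmul m (r • l) := by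
  rw [tmul, tmul, ← sub_eq_zero]
  exact (QuotientAddGroup.eq_zero_iff _).2 (AddSubgroup.subset_closure ⟨m, r, l, rfl⟩)

variable (M L) in
/-- The biadditive map `M × L → M ⊗ L`. -/
def mkHom : M →+ L →+ Tensor M L :=
  AddMonoidHom.mk' (fun m => AddMonoidHom.mk' (tmul m) (tmul_add m)) fun m m' => by
    ext l; exact add_tmul m m' l

lemma mkHom_apply (m : M) (l : L) : mkHom M L m l = tmul m l := rfl

lemma sum_tmul {ι : Type*} (s : Finset ι) (m : ι → M) (l : L) :
    tmul (∑ i ∈ s, m i) l = ∑ i ∈ s, tmul (m i) l := by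
  rw [← mkHom_apply, map_sum, AddMonoidHom.finsetSum_apply]; rfl

lemma tmul_sum {ι : Type*} (s : Finset ι) (m : M) (l : ι → L) :
    tmul m (∑ i ∈ s, l i) = ∑ i ∈ s, tmul m (l i) := map_sum (mkHom M L m) l s

lemma tmul_zero (m : M) : tmul m (0 : L) = 0 := map_zero (mkHom M L m)

/-- The additive map out of `M ⊗ L` defined by a balanced biadditive map. -/
def lift {A : Type*} [AddCommGroup A] (φ : M →+ L →+ A)
    (h : ∀ m (r : R) l, φ (MulOpposite.op r • m) l = φ m (r • l)) : Tensor M L →+ A :=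
  QuotientAddGroup.lift _ (TensorProduct.liftAddHom φ fun n m l => by simp) (by
    rw [tensorRel, AddSubgroup.closure_le]
    rintro _ ⟨m, r, l, rfl⟩
    simp [h])

@[elab_as_elim]
lemma induction_on {P : Tensor M L → Prop} (x : Tensor M L) (tmul : ∀ m l, P (tmul m l))
    (add : ∀ x y, P x → P y → P (x + y)) : P x := by
  obtain ⟨y, rfl⟩ := QuotientAddGroup.mk_surjective x
  induction y using TensorProduct.induction_on with
  | zero =>
    have h := tmul 0 0
    rwa [tmul_zero] at h
  | tmul m l => exact tmul m l
  | add y z hy hz => exact add _ _ hy hz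

end Tensor

/-- A finite presentation of a left module by generators `x` and relations `r`. -/
structure FinPres (L : ModuleCat.{u} R) where
  {n m : ℕ}
  x : Fin n → L
  r : Fin m → Fin n → R
  exists_sum (y : L) : ∃ c : Fin n → R, ∑ i, c i • x i = y
  sum_r (j : Fin m) : ∑ i, r j i • x i = 0
  exists_rel (c : Fin n → R) : ∑ i, c i • x i = 0 → ∃ d : Fin m → R, c = ∑ j, d j • r j

lemma exists_finPres (L : ModuleCat.{u} R) [Module.FinitePresentation R L] :
    Nonempty (FinPres L) := by
  obtain ⟨n, K, e, hK⟩ := Module.FinitePresentation.exists_fin R L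
  obtain ⟨m, r, hr⟩ := Submodule.fg_iff_exists_fin_generating_family.1 hK
  let q : (Fin n → R) →ₗ[R] L := e.symm.toLinearMap ∘ₗ K.mkQ
  have hq (c : Fin n → R) : ∑ i, c i • q (Pi.single i 1) = q c := by
    simp only [← map_smul, ← map_sum]
    congr 1
    ext j
    simp [Finset.sum_apply, Pi.single_apply]
  have hq0 (c : Fin n → R) : q c = 0 ↔ c ∈ K := by simp [q]
  refine ⟨⟨fun i => q (Pi.single i 1), r, fun y => ?_, fun j => ?_, fun c hc => ?_⟩⟩
  · obtain ⟨c, hc⟩ := K.mkQ_surjective (e y)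
    exact ⟨c, by rw [hq]; simp [q, hc]⟩
  · rw [hq, hq0, ← hr]
    exact Submodule.subset_span ⟨j, rfl⟩
  · rw [hq, hq0, ← hr] at hc
    obtain ⟨d, hd⟩ := (Submodule.mem_span_range_iff_exists_fun R).1 hc
    exact ⟨d, hd.symm⟩

namespace FinPres

variable {L : ModuleCat.{u} R} (p : FinPres L) (M : RMod R)

lemma exists_sum_tmul {M : RMod R} (z : Tensor M L) :
    ∃ a : Fin p.n → M, ∑ i, Tensor.tmul (a i) (p.x i) = z := by
  induction z using Tensor.induction_on with
  | tmul m l =>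
    obtain ⟨c, rfl⟩ := p.exists_sum l
    exact ⟨fun i => MulOpposite.op (c i) • m, by simp only [Tensor.smul_tmul, Tensor.tmul_sum]⟩
  | add y z hy hz =>
    obtain ⟨a, rfl⟩ := hy
    obtain ⟨b, rfl⟩ := hz
    exact ⟨a + b, by simp [Tensor.add_tmul, Finset.sum_add_distrib]⟩

/-- The map `M^m → M^n` given by the relations. -/
def relHom : (Fin p.m → M) →+ (Fin p.n → M) :=
  AddMonoidHom.mk' (fun b i => ∑ j, MulOpposite.op (p.r j i) • b j) fun b b' => by
    ext i; simp [smul_add, Finset.sum_add_distrib]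

/-- The map `M × R^n → M^n`. -/
def coeffHom : M →+ (Fin p.n → R) →+ (Fin p.n → M) :=
  AddMonoidHom.mk' (fun m => AddMonoidHom.mk' (fun c i => MulOpposite.op (c i) • m)
    fun c c' => by ext i; simp [add_smul]) fun m m' => by ext c i; simp [smul_add]

/-- A syzygy of the generators is a combination of the given relations, with coefficients `d`; the
preimage is `m d`. Hence `tensorToQuot` does not depend on the coefficients chosen for an element of
`L`. -/
lemma coeffHom_mem (m : M) (c : Fin p.n → R) (h : ∑ i, c i • p.x i = 0) :
    p.coeffHom M m c ∈ (p.relHom M).range := by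
  obtain ⟨d, rfl⟩ := p.exists_rel c h
  refine ⟨fun j => MulOpposite.op (d j) • m, ?_⟩
  ext i
  simp [relHom, coeffHom, smul_smul, ← Finset.sum_smul, Finset.sum_apply]

/-- The coefficients of an element. -/
def coeff (l : L) : Fin p.n → R := (p.exists_sum l).choose

lemma sum_coeff (l : L) : ∑ i, p.coeff l i • p.x i = l := (p.exists_sum l).choose_spec

lemma mk_coeffHom_eq (m : M) (c c' : Fin p.n → R)
    (h : ∑ i, c i • p.x i = ∑ i, c' i • p.x i) :
    (QuotientAddGroup.mk (p.coeffHom M m c) : (Fin p.n → M) ⧸ (p.relHom M).range) =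
      QuotientAddGroup.mk (p.coeffHom M m c') := by
  rw [QuotientAddGroup.eq, ← map_neg, ← map_add]
  apply coeffHom_mem
  simp [add_smul, Finset.sum_add_distrib, h]

/-- The map `M ⊗ L → M^n / M^m`, `m ⊗ l ↦ (m cᵢ)` for coefficients `c` of `l`. -/
def tensorToQuot : Tensor M L →+ (Fin p.n → M) ⧸ (p.relHom M).range :=
  Tensor.lift
    (AddMonoidHom.mk' (fun m => AddMonoidHom.mk' (fun l =>
      QuotientAddGroup.mk (p.coeffHom M m (p.coeff l)))
      fun l l' => by
        rw [← QuotientAddGroup.mk_add, ← map_add]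
        apply mk_coeffHom_eq
        simp [add_smul, Finset.sum_add_distrib, sum_coeff])
      fun m m' => by
        ext l
        simp)
    fun m r l => by
      have h : p.coeffHom M (MulOpposite.op r • m) (p.coeff l) =
          p.coeffHom M m (r • p.coeff l) := by
        ext i
        simp [coeffHom, smul_smul]
      change QuotientAddGroup.mk _ = QuotientAddGroup.mk _
      rw [h]
      apply mk_coeffHom_eq
      simp [mul_smul, ← Finset.smul_sum, sum_coeff]

lemma tensorToQuot_sum (a : Fin p.n → M) :
    p.tensorToQuot M (∑ i, Tensor.tmul (a i) (p.x i)) = QuotientAddGroup.mk a := by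
  have h (i : Fin p.n) : p.tensorToQuot M (Tensor.tmul (a i) (p.x i)) =
      QuotientAddGroup.mk (Pi.single i (a i)) := by
    -- The chosen coefficients of `p.x i` need not form the basis vector, but modulo relations they
    -- may be replaced by it.
    refine (p.mk_coeffHom_eq M (a i) (p.coeff (p.x i)) (Pi.single i 1) ?_).trans ?_
    · simp [sum_coeff, Pi.single_apply]
    · congr 1
      ext j
      by_cases hj : j = i
      · subst hj; simp [coeffHom]
      · simp [coeffHom, hj]
  rw [map_sum]
  simp only [h]
  rw [← QuotientAddGroup.mk_sum, Finset.univ_sum_single]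

/-- Exactness of `M^m ⟶ M^n ⟶ M ⊗ L` in the middle. The nontrivial direction applies `tensorToQuot`,
which recovers the class of `a`. -/
lemma sum_tmul_eq_zero_iff (a : Fin p.n → M) :
    ∑ i, Tensor.tmul (a i) (p.x i) = 0 ↔
      ∃ b : Fin p.m → M, ∀ i, ∑ j, MulOpposite.op (p.r j i) • b j = a i := by
  constructor
  · intro h
    have h2 := p.tensorToQuot_sum M a
    rw [h, map_zero, eq_comm, QuotientAddGroup.eq_zero_iff] at h2
    obtain ⟨b, rfl⟩ := h2
    exact ⟨b, fun i => rfl⟩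
  · rintro ⟨b, hb⟩
    simp only [← hb, Tensor.sum_tmul, Tensor.smul_tmul]
    rw [Finset.sum_comm]
    simp only [← Tensor.tmul_sum, sum_r, Tensor.tmul_zero, Finset.sum_const_zero]

end FinPres

/-- The functor `M ↦ M ⊗ L`. -/
def tensorWith (L : ModuleCat.{u} R) : RMod R ⥤ AddCommGrpCat.{u} where
  obj M := AddCommGrpCat.of (Tensor M L)
  map f := AddCommGrpCat.ofHom (Tensor.map f (𝟙 L))
  map_id _ := AddCommGrpCat.hom_ext (Tensor.hom_ext fun _ _ => rfl)
  map_comp _ _ := AddCommGrpCat.hom_ext (Tensor.hom_ext fun _ _ => rfl)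

instance (L : ModuleCat.{u} R) : (tensorWith L).Additive where
  map_add {_ _ f g} := AddCommGrpCat.hom_ext (Tensor.hom_ext fun m l =>
    Tensor.add_tmul (f m) (g m) l)

variable (R) in
/-- The free right module of rank `n`. -/
abbrev freeRight (n : ℕ) : RMod R := ModuleCat.of Rᵐᵒᵖ (Fin n → Rᵐᵒᵖ)

/-- The homomorphism out of a free right module given by the images of the basis. -/
def freeDesc {n : ℕ} {M : RMod R} (a : Fin n → M) : freeRight R n ⟶ M :=
  ModuleCat.ofHom (Fintype.linearCombination Rᵐᵒᵖ a)

lemma freeDesc_single {n : ℕ} {M : RMod R} (a : Fin n → M) (i : Fin n) :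
    freeDesc a (Pi.single i 1 : Fin n → Rᵐᵒᵖ) = a i := by
  simp [freeDesc]

lemma free_hom_ext {n : ℕ} {M : RMod R} {f g : freeRight R n ⟶ M}
    (h : ∀ i, f (Pi.single i 1 : Fin n → Rᵐᵒᵖ) = g (Pi.single i 1 : Fin n → Rᵐᵒᵖ)) : f = g := by
  ext1
  refine LinearMap.pi_ext' fun i => LinearMap.ext_ring ?_
  exact h i

/-- As `M^n = Hom(R^n, M)`, the exact sequence `M^m ⟶ M^n ⟶ M ⊗ L ⟶ 0` is itself a presentation by
representables, with generator `∑ eᵢ ⊗ xᵢ` and the transposed relation matrix as `f`. -/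
lemma isFp_tensorWith (L : ModuleCat.{u} R) [Module.FinitePresentation R L] :
    isFp (RMod R) (tensorWith L) := by
  obtain ⟨p⟩ := exists_finPres L
  let e (i : Fin p.n) : freeRight R p.n := (Pi.single i 1 : Fin p.n → Rᵐᵒᵖ)
  have hmap {M : RMod R} (a : freeRight R p.n ⟶ M) :
      (tensorWith L).map a (∑ i, Tensor.tmul (e i) (p.x i)) =
        ∑ i, Tensor.tmul (a (e i)) (p.x i) :=
    map_sum (Tensor.map a (𝟙 L)) _ _
  refine isFp_of_generator _
    (freeDesc fun i => (fun j => MulOpposite.op (p.r j i) : Fin p.m → Rᵐᵒᵖ) :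
      freeRight R p.n ⟶ freeRight R p.m) (∑ i, Tensor.tmul (e i) (p.x i)) (fun M z => ?_)
    fun M a => ?_
  · obtain ⟨a, ha⟩ := p.exists_sum_tmul z
    exact ⟨freeDesc a, by
      rw [hmap, ← ha]
      exact Finset.sum_congr rfl fun i _ => by rw [freeDesc_single]⟩
  · rw [hmap]
    refine (p.sum_tmul_eq_zero_iff M _).trans ?_
    have hcomp (b : Fin p.m → M) (i : Fin p.n) :
        (freeDesc (fun i => (fun j => MulOpposite.op (p.r j i) : Fin p.m → Rᵐᵒᵖ)) ≫ freeDesc b :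
          freeRight R p.n ⟶ M) (e i) = ∑ j, MulOpposite.op (p.r j i) • b j := by
      rw [ConcreteCategory.comp_apply, freeDesc_single]
      simp [freeDesc, Fintype.linearCombination_apply]
    constructor
    · rintro ⟨b, hb⟩
      exact ⟨freeDesc b, free_hom_ext fun i => (hcomp b i).trans (hb i)⟩
    · rintro ⟨b, hb⟩
      refine ⟨fun j => b (Pi.single j 1 : Fin p.m → Rᵐᵒᵖ), fun i => ?_⟩
      rw [← hcomp, ← hb]
      have : b = freeDesc fun j => b (Pi.single j 1 : Fin p.m → Rᵐᵒᵖ) :=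
        free_hom_ext fun j => by rw [freeDesc_single]
      rw [← this]

end TensorFp

/-! ## The functors `D_R G` are finitely presented -/

section DRFp

variable {R : Type u} [Ring R]

instance (G : LFun R) : G.obj.Additive := G.property

instance (L : LfpMod R) : Module.FinitePresentation R L.obj := L.property

lemma Tensor.map_map {M M' M'' : RMod R} {L L' L'' : ModuleCat.{u} R} (a : M ⟶ M') (b : M' ⟶ M'')
    (g : L ⟶ L') (h : L' ⟶ L'') (z : Tensor M L) :
    Tensor.map b h (Tensor.map a g z) = Tensor.map (a ≫ b) (g ≫ h) z :=
  DFunLike.congr_fun (f := (Tensor.map b h).comp (Tensor.map a g)) (g := Tensor.map (a ≫ b) (g ≫ h))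
    (Tensor.hom_ext fun _ _ => rfl) z

lemma Tensor.map_comm {M M' : RMod R} {L L' : ModuleCat.{u} R} (a : M ⟶ M') (g : L ⟶ L')
    (z : Tensor M L) :
    Tensor.map a (𝟙 L') (Tensor.map (𝟙 M) g z) = Tensor.map (𝟙 M') g (Tensor.map a (𝟙 L) z) := by
  rw [Tensor.map_map, Tensor.map_map, Category.id_comp, Category.comp_id, Category.id_comp,
    Category.comp_id]

variable (R) in
/-- The equivalence from a small category to `mod(Rᵒᵖ)`. -/
abbrev ofSmall : SmallModel.{u} (LfpMod R) ⥤ LfpMod R := (equivSmallModel.{u} (LfpMod R)).inverse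

/-- The elements of `G`. -/
abbrev Elts (G : LFun R) : Type u := Σ s : SmallModel.{u} (LfpMod R), G.obj.obj ((ofSmall R).obj s)

/-- Pairs of parallel morphisms, together with two elements of `G` over their source. -/
abbrev EltPairs (G : LFun R) : Type u :=
  Σ s s' : SmallModel.{u} (LfpMod R), ((s ⟶ s') × (s ⟶ s')) ×
    (G.obj.obj ((ofSmall R).obj s) × G.obj.obj ((ofSmall R).obj s))

/-- The functor of families indexed by the elements of `G`. -/
def families (G : LFun R) : RMod R ⥤ AddCommGrpCat.{u} :=
  piFunctor fun i : Elts G => tensorWith ((ofSmall R).obj i.1).obj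

/-- The functor in which the conditions on a family to be a natural transformation take values. -/
def conditions (G : LFun R) : RMod R ⥤ AddCommGrpCat.{u} :=
  piFunctor fun j : EltPairs G => tensorWith ((ofSmall R).obj j.2.1).obj

/-- The failure of a family to be additive and natural. -/
def defectHom (G : LFun R) (M : RMod R) :
    (∀ i : Elts G, Tensor M ((ofSmall R).obj i.1).obj) →+
      ∀ j : EltPairs G, Tensor M ((ofSmall R).obj j.2.1).obj :=
  AddMonoidHom.mk' (fun c j =>
    c ⟨j.2.1, G.obj.map ((ofSmall R).map j.2.2.1.1) j.2.2.2.1 +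
      G.obj.map ((ofSmall R).map j.2.2.1.2) j.2.2.2.2⟩ -
    (Tensor.map (𝟙 M) ((ofSmall R).map j.2.2.1.1).hom (c ⟨j.1, j.2.2.2.1⟩) +
      Tensor.map (𝟙 M) ((ofSmall R).map j.2.2.1.2).hom (c ⟨j.1, j.2.2.2.2⟩))) fun c c' => by
    ext j
    simp only [Pi.add_apply, map_add]
    abel

lemma defectHom_map (G : LFun R) {M M' : RMod R} (a : M ⟶ M')
    (c : ∀ i : Elts G, Tensor M ((ofSmall R).obj i.1).obj) (j : EltPairs G) :
    defectHom G M' (fun i => Tensor.map a (𝟙 _) (c i)) j =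
      Tensor.map a (𝟙 _) (defectHom G M c j) := by
  simp only [defectHom, AddMonoidHom.mk'_apply, map_sub, map_add, Tensor.map_comm]

/-- The natural transformation given by `defectHom`. -/
def defectNat (G : LFun R) : families G ⟶ conditions G where
  app M := AddCommGrpCat.ofHom (defectHom G M)
  naturality M M' a := by
    refine AddCommGrpCat.hom_ext (AddMonoidHom.ext fun c => funext fun j => ?_)
    exact defectHom_map G a c j

/-- The family of values of a natural transformation. -/
def valuesHom (G : LFun R) (M : RMod R) :
    ((restrictedHom (RMod R) (t R)).obj (op G)).obj M →+
      ∀ i : Elts G, Tensor M ((ofSmall R).obj i.1).obj :=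
  (AddMonoidHom.mk' (fun (φ : G ⟶ (t R).obj M) (i : Elts G) =>
      (show Tensor M ((ofSmall R).obj i.1).obj from φ.hom.app ((ofSmall R).obj i.1) i.2))
    fun _ _ => rfl).comp (restrictedHomEquiv (t R) (op G) M).symm.toAddMonoidHom

lemma valuesHom_apply (G : LFun R) (M : RMod R) (φ : G ⟶ (t R).obj M) (i : Elts G) :
    valuesHom G M (restrictedHomEquiv (t R) (op G) M φ) i =
      φ.hom.app ((ofSmall R).obj i.1) i.2 := by
  have h := (restrictedHomEquiv (t R) (op G) M).symm_apply_apply φ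
  exact congrArg (fun ψ : G ⟶ (t R).obj M => ψ.hom.app ((ofSmall R).obj i.1) i.2) h

/-- The natural transformation given by `valuesHom`. -/
def valuesNat (G : LFun R) : (restrictedHom (RMod R) (t R)).obj (op G) ⟶ families G where
  app M := AddCommGrpCat.ofHom (valuesHom G M)
  naturality M M' a := by
    refine AddCommGrpCat.hom_ext (AddMonoidHom.ext fun z => funext fun i => ?_)
    obtain ⟨φ, rfl⟩ := (restrictedHomEquiv (t R) (op G) M).surjective z
    change valuesHom G M' (((restrictedHom (RMod R) (t R)).obj (op G)).map a _) i =
      Tensor.map a (𝟙 _) (valuesHom G M _ i)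
    rw [restrictedHom_map_apply, valuesHom_apply, valuesHom_apply]
    rfl

lemma valuesHom_injective (G : LFun R) (M : RMod R) : Function.Injective (valuesHom G M) := by
  intro z z' h
  obtain ⟨φ, rfl⟩ := (restrictedHomEquiv (t R) (op G) M).surjective z
  obtain ⟨φ', rfl⟩ := (restrictedHomEquiv (t R) (op G) M).surjective z'
  congr 1
  apply ObjectProperty.hom_ext
  apply ((Functor.whiskeringLeft _ _ AddCommGrpCat.{u}).obj (ofSmall R)).map_injective
  ext s g
  have h' := congrFun h ⟨s, g⟩
  rw [valuesHom_apply, valuesHom_apply] at h'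
  exact h'

lemma defectHom_eq_zero_iff (G : LFun R) (M : RMod R)
    (c : ∀ i : Elts G, Tensor M ((ofSmall R).obj i.1).obj) :
    defectHom G M c = 0 ↔ ∀ (s s' : SmallModel.{u} (LfpMod R)) (h h' : s ⟶ s')
      (g g' : G.obj.obj ((ofSmall R).obj s)),
      c ⟨s', G.obj.map ((ofSmall R).map h) g + G.obj.map ((ofSmall R).map h') g'⟩ =
        Tensor.map (𝟙 M) ((ofSmall R).map h).hom (c ⟨s, g⟩) +
          Tensor.map (𝟙 M) ((ofSmall R).map h').hom (c ⟨s, g'⟩) := by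
  constructor
  · intro hc s s' h h' g g'
    exact sub_eq_zero.1 (congrFun hc ⟨s, s', (h, h'), (g, g')⟩)
  · intro hc
    funext j
    exact sub_eq_zero.2 (hc _ _ _ _ _ _)

/-- The one condition imposed on pairs encodes both additivity and naturality. A family satisfying
it is a transformation on the small model, which extends along the equivalence. -/
lemma exact_valuesHom_defectHom (G : LFun R) (M : RMod R) :
    Function.Exact (valuesHom G M) (defectHom G M) := by
  intro c
  rw [defectHom_eq_zero_iff]
  constructor
  · intro hc
    have hadd (s) (g g' : G.obj.obj ((ofSmall R).obj s)) : c ⟨s, g + g'⟩ = c ⟨s, g⟩ + c ⟨s, g'⟩ := by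
      -- Two identities give additivity.
      have h := hc s s (𝟙 s) (𝟙 s) g g'
      have hG (y : G.obj.obj ((ofSmall R).obj s)) : G.obj.map ((ofSmall R).map (𝟙 s)) y = y := by
        rw [(ofSmall R).map_id, G.obj.map_id]
        rfl
      rw [hG, hG, (ofSmall R).map_id] at h
      refine h.trans ?_
      have hid (z : Tensor M ((ofSmall R).obj s).obj) :
          Tensor.map (𝟙 M) (𝟙 ((ofSmall R).obj s).obj) z = z :=
        DFunLike.congr_fun (f := Tensor.map (𝟙 M) (𝟙 ((ofSmall R).obj s).obj))
            (g := AddMonoidHom.id _) (Tensor.hom_ext fun _ _ => rfl) z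
      exact congrArg₂ (· + ·) (hid _) (hid _)
    have hzero (s) : c ⟨s, 0⟩ = 0 := by
      have h := hadd s 0 0
      rwa [add_zero, left_eq_add] at h
    have hnat {s s'} (h : s ⟶ s') (g : G.obj.obj ((ofSmall R).obj s)) :
        c ⟨s', G.obj.map ((ofSmall R).map h) g⟩ =
          Tensor.map (𝟙 M) ((ofSmall R).map h).hom (c ⟨s, g⟩) := by
      -- A zero second element leaves naturality; the second morphism is then irrelevant.
      have h2 := hc s s' h h g 0
      rwa [map_zero, add_zero, hzero, map_zero, add_zero] at h2
    let β : ofSmall R ⋙ G.obj ⟶ ofSmall R ⋙ ((t R).obj M).obj :=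
      { app s := AddCommGrpCat.ofHom (AddMonoidHom.mk'
          (fun g => (show Tensor M ((ofSmall R).obj s).obj from c ⟨s, g⟩)) (hadd s))
        naturality s s' h := AddCommGrpCat.hom_ext (AddMonoidHom.ext fun g => hnat h g) }
    obtain ⟨α, hα⟩ :=
      ((Functor.whiskeringLeft _ _ AddCommGrpCat.{u}).obj (ofSmall R)).map_surjective β
    refine ⟨restrictedHomEquiv (t R) (op G) M (ObjectProperty.homMk α), funext fun i => ?_⟩
    rw [valuesHom_apply]
    exact ConcreteCategory.congr_hom (NatTrans.congr_app hα i.1) i.2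
  · rintro ⟨z, rfl⟩ s s' h h' g g'
    obtain ⟨φ, rfl⟩ := (restrictedHomEquiv (t R) (op G) M).surjective z
    rw [valuesHom_apply, valuesHom_apply, valuesHom_apply, map_add, nat_apply, nat_apply]
    rfl

lemma isFp_preDR (G : (LFun R)ᵒᵖ) : isFp (RMod R) ((preDR R).obj G) :=
  isFp_of_kernel (K := (restrictedHom (RMod R) (t R)).obj G) (F := families G.unop)
    (F' := conditions G.unop)
    (isFp_piFunctor _ fun _ => isFp_tensorWith _) (isFp_piFunctor _ fun _ => isFp_tensorWith _)
    (valuesNat G.unop) (defectNat G.unop) (valuesHom_injective G.unop)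
    (exact_valuesHom_defectHom G.unop)

end DRFp

/-! ## Character modules -/

section Characters

/-- `χ` descends to `A ⧸ f.ker`, which embeds in `B`, and `ℚ/ℤ` is injective. -/
lemma exists_character_extension {A B : Type*} [AddCommGroup A] [AddCommGroup B] (f : A →+ B)
    (χ : CharacterModule A) (h : ∀ a, f a = 0 → χ a = 0) :
    ∃ χ' : CharacterModule B, ∀ a, χ' (f a) = χ a := by
  let χ₀ : CharacterModule (A ⧸ f.ker) := QuotientAddGroup.lift f.ker (χ : A →+ AddCircle (1 : ℚ)) h
  obtain ⟨χ', hχ'⟩ := CharacterModule.dual_surjective_of_injective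
    (QuotientAddGroup.kerLift f).toIntLinearMap (QuotientAddGroup.kerLift_injective f) χ₀
  exact ⟨χ', fun a => DFunLike.congr_fun hχ' (QuotientAddGroup.mk a)⟩

lemma exists_character_of_notMem {A : Type*} [AddCommGroup A] (B : AddSubgroup A) {a : A}
    (ha : a ∉ B) : ∃ χ : CharacterModule A, (∀ b ∈ B, χ b = 0) ∧ χ a ≠ 0 := by
  have h : (QuotientAddGroup.mk a : A ⧸ B) ≠ 0 := by
    rwa [Ne, QuotientAddGroup.eq_zero_iff]
  obtain ⟨χ, hχ⟩ := CharacterModule.exists_character_apply_ne_zero_of_ne_zero h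
  refine ⟨(AddMonoidHom.comp (χ : (A ⧸ B) →+ AddCircle (1 : ℚ)) (QuotientAddGroup.mk' B) : _), ?_,
    hχ⟩
  intro b hb
  have : (QuotientAddGroup.mk b : A ⧸ B) = 0 := (QuotientAddGroup.eq_zero_iff b).2 hb
  exact (congrArg χ this).trans (map_zero χ)

lemma exists_character_components {N : Type*} [AddCommGroup N] {n : ℕ}
    (χ : CharacterModule (Fin n → N)) :
    ∃ ν : Fin n → CharacterModule N, ∀ c, χ c = ∑ i, ν i (c i) := by
  refine ⟨fun i => (AddMonoidHom.comp (χ : (Fin n → N) →+ AddCircle (1 : ℚ))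
    (AddMonoidHom.single (fun _ => N) i) : _), fun c => ?_⟩
  conv_lhs => rw [← Finset.univ_sum_single c, map_sum]
  rfl

variable {R : Type u} [Ring R]

instance (N : Type*) [AddCommGroup N] [Module R N] : Module Rᵐᵒᵖ (CharacterModule N) where
  smul r χ := (AddMonoidHom.comp (χ : N →+ AddCircle (1 : ℚ))
    (DistribSMul.toAddMonoidHom N r.unop) : _)
  one_smul χ := CharacterModule.ext _ fun x => congrArg χ (one_smul R x)
  mul_smul r s χ := CharacterModule.ext _ fun x => congrArg χ (mul_smul s.unop r.unop x)
  smul_zero _ := rfl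
  smul_add _ _ _ := rfl
  add_smul r s χ := CharacterModule.ext _ fun x =>
    (congrArg χ (add_smul r.unop s.unop x)).trans (map_add χ _ _)
  zero_smul χ := CharacterModule.ext _ fun x => (congrArg χ (zero_smul R x)).trans (map_zero χ)

/-- The right module `Hom_ℤ(N, ℚ/ℤ)`. -/
def dualMod (N : ModuleCat.{u} R) : RMod R := ModuleCat.of Rᵐᵒᵖ (CharacterModule N)

/-- Evaluation of a character. -/
def dualMod.eval {N : ModuleCat.{u} R} : dualMod N →+ N →+ AddCircle (1 : ℚ) where
  toFun ν := (show CharacterModule N from ν)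
  map_zero' := rfl
  map_add' _ _ := rfl

lemma dualMod.ext {N : ModuleCat.{u} R} {ν ν' : dualMod N}
    (h : ∀ y, dualMod.eval ν y = dualMod.eval ν' y) : ν = ν' :=
  CharacterModule.ext _ h

/-- The map `N* ⊗ M → Hom(M, N)*`. -/
def dualEv (N M : ModuleCat.{u} R) : Tensor (dualMod N) M →+ (M ⟶ N) →+ AddCircle (1 : ℚ) :=
  Tensor.lift
    (AddMonoidHom.mk' (fun ν => AddMonoidHom.mk' (fun m =>
        AddMonoidHom.mk' (fun h => dualMod.eval ν (h m)) fun h h' => map_add (dualMod.eval ν) _ _)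
        fun m m' => by ext h; simp)
      fun ν ν' => by ext m h; simp)
    fun ν r m => by
      ext h
      change dualMod.eval (MulOpposite.op r • ν) (h m) = dualMod.eval ν (h (r • m))
      exact congrArg (dualMod.eval ν) (map_smul h.hom r m).symm

lemma dualEv_map {N M M' : ModuleCat.{u} R} (g : M ⟶ M') (z : Tensor (dualMod N) M) (h : M' ⟶ N) :
    dualEv N M' (Tensor.map (𝟙 _) g z) h = dualEv N M z (g ≫ h) := by
  induction z using Tensor.induction_on with
  | tmul ν m => rfl
  | add x y hx hy => simp only [map_add, AddMonoidHom.add_apply, hx, hy]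

namespace FinPres

variable {M : ModuleCat.{u} R} (p : FinPres M)

lemma hom_ext {N : ModuleCat.{u} R} {h h' : M ⟶ N} (e : ∀ i, h (p.x i) = h' (p.x i)) : h = h' := by
  ext l
  obtain ⟨c, rfl⟩ := p.exists_sum l
  simp only [map_sum, map_smul, e]

lemma exists_hom {N : ModuleCat.{u} R} (y : Fin p.n → N) (hy : ∀ j, ∑ i, p.r j i • y i = 0) :
    ∃ h : M ⟶ N, ∀ i, h (p.x i) = y i := by
  let q : (Fin p.n → R) →ₗ[R] M := Fintype.linearCombination R p.x
  let k : (Fin p.n → R) →ₗ[R] N := Fintype.linearCombination R y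
  have hq : Function.Surjective q := p.exists_sum
  have hk : LinearMap.ker q ≤ LinearMap.ker k := by
    intro c hc
    obtain ⟨d, rfl⟩ := p.exists_rel c hc
    rw [LinearMap.mem_ker, map_sum]
    refine Finset.sum_eq_zero fun j _ => ?_
    rw [map_smul]
    exact (congrArg (d j • ·) (hy j)).trans (smul_zero _)
  refine ⟨ModuleCat.ofHom ((LinearMap.ker q).liftQ k hk ∘ₗ
    (q.quotKerEquivOfSurjective hq).symm.toLinearMap), fun i => ?_⟩
  have hx : p.x i = q (Pi.single i 1) := by simp [q]
  have : (q.quotKerEquivOfSurjective hq).symm (p.x i) = (LinearMap.ker q).mkQ (Pi.single i 1) := by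
    rw [LinearEquiv.symm_apply_eq, hx]
    rfl
  change (LinearMap.ker q).liftQ k hk ((q.quotKerEquivOfSurjective hq).symm (p.x i)) = y i
  rw [this, Submodule.mkQ_apply, Submodule.liftQ_apply]
  simp [k]

lemma dualEv_sum {N : ModuleCat.{u} R} (ν : Fin p.n → dualMod N) (h : M ⟶ N) :
    dualEv N M (∑ i, Tensor.tmul (ν i) (p.x i)) h = ∑ i, dualMod.eval (ν i) (h (p.x i)) := by
  rw [map_sum, AddMonoidHom.finsetSum_apply]
  rfl

/-- Evaluation at the generators embeds `Hom(M, N)` in `N^n`. A character extends to `N^n`, and its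
components `νᵢ` give the preimage `∑ νᵢ ⊗ xᵢ`. -/
lemma dualEv_surjective (p : FinPres M) (N : ModuleCat.{u} R) : Function.Surjective (dualEv N M) := by
  intro θ
  let f : (M ⟶ N) →+ (Fin p.n → N) := AddMonoidHom.mk' (fun h i => h (p.x i)) fun h h' => rfl
  obtain ⟨χ, hχ⟩ := exists_character_extension f θ fun h hh => by
    have : h = 0 := p.hom_ext fun i => congrFun hh i
    rw [this]
    exact map_zero θ
  obtain ⟨ν, hν⟩ := exists_character_components χ
  refine ⟨∑ i, Tensor.tmul (M := dualMod N) (ν i) (p.x i), ?_⟩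
  ext h
  exact (p.dualEv_sum (N := N) ν h).trans ((hν (f h)).symm.trans (hχ h))

/-- Dualize `0 ⟶ Hom(M, N) ⟶ N^n ⟶ N^m`: if `∑ νᵢ ⊗ xᵢ` maps to zero, the character `(νᵢ)` vanishes
on the kernel of `N^n ⟶ N^m`, so it comes from a character `(μⱼ)` of `N^m`. Then `νᵢ = ∑ μⱼ rⱼᵢ`,
the criterion of `sum_tmul_eq_zero_iff`. -/
lemma dualEv_injective (p : FinPres M) (N : ModuleCat.{u} R) : Function.Injective (dualEv N M) := by
  rw [injective_iff_map_eq_zero]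
  intro z hz
  obtain ⟨ν, rfl⟩ := p.exists_sum_tmul z
  let χ : (Fin p.n → N) →+ AddCircle (1 : ℚ) :=
    ∑ i, (dualMod.eval (ν i)).comp (Pi.evalAddMonoidHom _ i)
  have hχ (c) : χ c = ∑ i, dualMod.eval (ν i) (c i) := by simp [χ]
  let f : (Fin p.n → N) →+ (Fin p.m → N) :=
    AddMonoidHom.mk' (fun c j => ∑ i, p.r j i • c i) fun c c' => by
      ext j; simp [Finset.sum_add_distrib]
  obtain ⟨χ', hχ'⟩ := exists_character_extension f χ fun c hc => by
    obtain ⟨h, hh⟩ := p.exists_hom c fun j => congrFun hc j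
    have h2 := DFunLike.congr_fun hz h
    rw [dualEv_sum] at h2
    simp only [hh] at h2
    exact (hχ c).trans h2
  obtain ⟨μ, hμ⟩ := exists_character_components χ'
  rw [sum_tmul_eq_zero_iff]
  refine ⟨μ, fun i => dualMod.ext fun y => ?_⟩
  have h1 : χ (Pi.single i y) = dualMod.eval (ν i) y := by
    rw [hχ, Finset.sum_eq_single i]
    · simp
    · intro j _ hj; simp [hj]
    · simp
  have h2 : f (Pi.single i y) = fun j => p.r j i • y := by
    funext j
    change ∑ k, p.r j k • (Pi.single i y : Fin p.n → N) k = _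
    rw [Finset.sum_eq_single i]
    · simp
    · intro k _ hk; simp [hk]
    · simp
  have h3 : χ' (f (Pi.single i y)) = χ (Pi.single i y) := hχ' _
  rw [← h1, ← h3, h2, hμ, map_sum, AddMonoidHom.finsetSum_apply]
  rfl

end FinPres

lemma dualEv_bijective (N M : ModuleCat.{u} R) [Module.FinitePresentation R M] :
    Function.Bijective (dualEv N M) := by
  obtain ⟨p⟩ := exists_finPres M
  exact ⟨p.dualEv_injective N, p.dualEv_surjective N⟩

/-- A character of `H N` induces a natural transformation `H ⟶ N* ⊗ -`. -/
lemma exists_hom_of_character (H : LFun R) (N : LfpMod R) (χ : H.obj.obj N →+ AddCircle (1 : ℚ)) :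
    ∃ φ : H ⟶ (t R).obj (dualMod N.obj), ∀ (M : LfpMod R) (z : H.obj.obj M) (h : M ⟶ N),
      dualEv N.obj M.obj (φ.hom.app M z) h.hom = χ (H.obj.map h z) := by
  let e (M : LfpMod R) := AddEquiv.ofBijective _ (dualEv_bijective N.obj M.obj)
  -- The Yoneda transformation `H M ⟶ Hom(M, N)*`, `z ↦ (h ↦ χ (H h z))`, to be transported along
  -- `dualEv`.
  let θ (M : LfpMod R) : H.obj.obj M →+ (M.obj ⟶ N.obj) →+ AddCircle (1 : ℚ) :=
    AddMonoidHom.mk' (fun z => AddMonoidHom.mk'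
      (fun h => χ (H.obj.map (ObjectProperty.homMk h : M ⟶ N) z))
        fun h h' => by
          rw [← map_add, ← map_add_apply']
          rfl)
      fun z z' => by ext h; simp
  have he (M : LfpMod R) (z : H.obj.obj M) :
      dualEv N.obj M.obj ((e M).symm (θ M z)) = θ M z := (e M).apply_symm_apply _
  refine ⟨ObjectProperty.homMk
    { app M := AddCommGrpCat.ofHom ((e M).symm.toAddMonoidHom.comp (θ M))
      naturality M M' g := ?_ }, fun M z h => DFunLike.congr_fun (he M z) h.hom⟩
  refine AddCommGrpCat.hom_ext (AddMonoidHom.ext fun z => ?_)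
  apply (dualEv_bijective N.obj M'.obj).1
  ext h
  change dualEv N.obj M'.obj ((e M').symm (θ M' (H.obj.map g z))) h =
    dualEv N.obj M'.obj (Tensor.map (𝟙 _) g.hom ((e M).symm (θ M z))) h
  rw [dualEv_map, he, he]
  change χ (H.obj.map _ (H.obj.map g z)) = χ (H.obj.map _ z)
  rw [← map_comp_apply']
  rfl

lemma exists_hom_apply_ne_zero (H : LFun R) (N : LfpMod R) (z : H.obj.obj N) (hz : z ≠ 0) :
    ∃ φ : H ⟶ (t R).obj (dualMod N.obj), φ.hom.app N z ≠ 0 := by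
  obtain ⟨χ, hχ⟩ := CharacterModule.exists_character_apply_ne_zero_of_ne_zero hz
  obtain ⟨φ, hφ⟩ := exists_hom_of_character H N χ
  refine ⟨φ, fun h0 => hχ ?_⟩
  -- Testing against the identity of `N` recovers `χ z`.
  have h := hφ N z (𝟙 N)
  rw [H.obj.map_id, h0] at h
  exact h.symm.trans (DFunLike.congr_fun (map_zero (dualEv N.obj N.obj)) (𝟙 N.obj))

/-- Take a character of `H N` that kills the image of `γ` but not `z`. The induced `φ` kills `γ` at
every `M`, because `H h` maps the image of `γ` at `M` into its image at `N`. -/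
lemma exists_hom_comp_eq_zero {G H : LFun R} (γ : G ⟶ H) (N : LfpMod R) (z : H.obj.obj N)
    (hz : z ∉ Set.range (γ.hom.app N)) :
    ∃ φ : H ⟶ (t R).obj (dualMod N.obj), γ ≫ φ = 0 ∧ φ.hom.app N z ≠ 0 := by
  obtain ⟨χ, h0, hχ⟩ := exists_character_of_notMem (γ.hom.app N).hom.range (a := z) hz
  obtain ⟨φ, hφ⟩ := exists_hom_of_character H N χ
  refine ⟨φ, ?_, fun h0 => hχ ?_⟩
  · ext M y
    apply (dualEv_bijective N.obj M.obj).1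
    ext h
    refine (hφ M (γ.hom.app M y) (ObjectProperty.homMk h)).trans ?_
    rw [← nat_apply]
    refine (h0 _ ⟨_, rfl⟩).trans ?_
    exact (DFunLike.congr_fun (map_zero (dualEv N.obj M.obj)) h).symm
  · have h := hφ N z (𝟙 N)
    rw [H.obj.map_id, h0] at h
    exact h.symm.trans (DFunLike.congr_fun (map_zero (dualEv N.obj N.obj)) (𝟙 N.obj))

end Characters

/-! ## The tensor embedding is full -/

section Full

variable (R : Type u) [Ring R]

/-- The regular left module. -/
def regular : LfpMod R :=
  ⟨ModuleCat.of R R, inferInstanceAs (Module.FinitePresentation R R)⟩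

variable {R}

/-- The homomorphism `R ⟶ L` with value `l` at `1`. -/
def ofElt {L : LfpMod R} (l : L.obj) : regular R ⟶ L :=
  ObjectProperty.homMk (ModuleCat.ofHom (LinearMap.toSpanSingleton R L.obj l))

lemma ofElt_one {L : LfpMod R} (l : L.obj) : (ofElt l).hom (1 : R) = l := one_smul R l

/-- The map `M ⊗ R → M`. -/
def tensorRegular (M : RMod R) : Tensor M (regular R).obj →+ M :=
  Tensor.lift
    (AddMonoidHom.mk' (fun m => AddMonoidHom.mk' (fun r : R => MulOpposite.op r • m)
      fun r s => add_smul (MulOpposite.op (show R from r)) (MulOpposite.op (show R from s)) m) fun m m' => by ext r; exact smul_add _ _ _)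
    fun m r s => smul_smul (MulOpposite.op (show R from s)) (MulOpposite.op r) m

/-- The element `m ⊗ 1`. -/
def tmulOne {M : RMod R} (m : M) : Tensor M (regular R).obj :=
  Tensor.tmul (L := (regular R).obj) m (1 : R)

lemma tmulOne_add {M : RMod R} (m m' : M) : tmulOne (m + m') = tmulOne m + tmulOne m' :=
  Tensor.add_tmul m m' _

lemma tmulOne_tensorRegular {M : RMod R} (z : Tensor M (regular R).obj) :
    tmulOne (tensorRegular M z) = z := by
  induction z using Tensor.induction_on with
  | tmul m r =>
    refine (Tensor.smul_tmul m r _).trans ?_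
    exact congrArg (Tensor.tmul m) (mul_one (show R from r))
  | add x y hx hy => rw [map_add, tmulOne_add, hx, hy]

lemma tensorRegular_map {M : RMod R} (z : Tensor M (regular R).obj) (r : R) :
    tensorRegular M (Tensor.map (𝟙 M) (ofElt (L := regular R) r).hom z) =
      MulOpposite.op r • tensorRegular M z := by
  induction z using Tensor.induction_on with
  | tmul m s =>
    exact (smul_smul (MulOpposite.op r) (MulOpposite.op (show R from s)) m).symm
  | add x y hx hy => simp only [map_add, hx, hy, smul_add]

/-- A transformation is determined by its component at `R`, as `m ⊗ l` is the image of `m ⊗ 1` under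
`R ⟶ L`, `1 ↦ l`. Naturality for the right multiplications of `R` makes the resulting map `M ⟶ M'`
linear. -/
instance : (t R).Full where
  map_surjective {M M'} φ := by
    let ψ : Tensor M (regular R).obj →+ Tensor M' (regular R).obj := (φ.hom.app (regular R)).hom
    have hψ {L : LfpMod R} (m : M) (l : L.obj) : φ.hom.app L (Tensor.tmul m l) =
        Tensor.map (𝟙 M') (ofElt l).hom (ψ (tmulOne m)) := by
      have h := nat_apply φ.hom (ofElt l) (tmulOne m)
      have h2 : ((t R).obj M).obj.map (ofElt l) (tmulOne m) = Tensor.tmul m l :=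
        congrArg (Tensor.tmul m) (ofElt_one l)
      rw [h2] at h
      exact h
    let a : M →ₗ[Rᵐᵒᵖ] M' :=
      { toFun m := tensorRegular M' (ψ (tmulOne m))
        map_add' m m' := by rw [tmulOne_add, map_add, map_add]
        map_smul' r m := by
          have h1 : tmulOne (r • m) = Tensor.tmul (L := (regular R).obj) m r.unop :=
            (Tensor.smul_tmul m r.unop _).trans
              (congrArg (Tensor.tmul m) (mul_one r.unop))
          have h2 : ψ (tmulOne (r • m)) =
            Tensor.map (𝟙 M') (ofElt (L := regular R) r.unop).hom (ψ (tmulOne m)) := by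
            rw [h1]; exact hψ m _
          rw [h2, tensorRegular_map]
          rfl }
    refine ⟨ModuleCat.ofHom a, ?_⟩
    ext L : 3
    refine AddCommGrpCat.hom_ext (Tensor.hom_ext fun m l => ?_)
    refine Eq.trans ?_ (hψ m l).symm
    rw [← tmulOne_tensorRegular (ψ (tmulOne m))]
    exact congrArg (Tensor.tmul (a m)) (ofElt_one l).symm

end Full

/-! ## The main theorem -/

section Main

variable {R : Type u} [Ring R]

lemma exists_lift_of_injective {G H K : LFun R} (γ : G ⟶ H)
    (hγ : ∀ L, Function.Injective (γ.hom.app L)) (ψ : K ⟶ H)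
    (h : ∀ L z, ψ.hom.app L z ∈ Set.range (γ.hom.app L)) : ∃ κ : K ⟶ G, κ ≫ γ = ψ := by
  choose k hk using h
  refine ⟨ObjectProperty.homMk
    { app L := AddCommGrpCat.ofHom (AddMonoidHom.mk' (k L) fun z z' => hγ L ?_)
      naturality L L' g := ?_ }, ?_⟩
  · rw [map_add, hk, hk, hk, map_add]
  · refine AddCommGrpCat.hom_ext (AddMonoidHom.ext fun z => hγ L' ?_)
    change γ.hom.app L' (k L' (K.obj.map g z)) = γ.hom.app L' (G.obj.map g (k L z))
    rw [hk, nat_apply, nat_apply, hk]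
  · ext L z
    exact hk L z

/-- The universal morphism from `G` to a functor `X ⊗ -`. -/
lemma gen_injective_and_exact (G : LFun R)
    (p : Presentation ((restrictedHom (RMod R) (t R)).obj (op G)))
    (γ : G ⟶ (t R).obj p.X) (hγ : restrictedHomEquiv (t R) (op G) p.X γ = p.gen) (L : LfpMod R) :
    Function.Injective (γ.hom.app L) ∧
      ∀ z, ((t R).map p.f).hom.app L z = 0 → z ∈ Set.range (γ.hom.app L) := by
  constructor
  · refine (injective_iff_map_eq_zero (γ.hom.app L).hom).2 fun g hg => ?_
    by_contra hne
    obtain ⟨φ, hφ⟩ := exists_hom_apply_ne_zero G L g hne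
    -- `p.gen` generates, so the detecting morphism `φ` factors through `γ`, although `γ` kills `g`.
    obtain ⟨a, ha⟩ := p.exists_map_eq (restrictedHomEquiv (t R) (op G) _ φ)
    rw [← hγ, restrictedHom_map_apply] at ha
    have ha' : γ ≫ (t R).map a = φ := (restrictedHomEquiv (t R) (op G) _).injective ha
    apply hφ
    rw [← ha']
    exact (congrArg (((t R).map a).hom.app L) hg).trans (map_zero _)
  · intro z hz
    by_contra hne
    obtain ⟨φ, hφ, hφz⟩ := exists_hom_comp_eq_zero γ L z hne
    obtain ⟨a, rfl⟩ := (t R).map_surjective φ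
    -- `γ ≫ (t R).map a = 0` says that `a` kills the generator of `D_R G`.
    obtain ⟨b, rfl⟩ := p.exists_factor a (by
      rw [← hγ, restrictedHom_map_apply]
      exact (congrArg _ hφ).trans (map_zero _))
    apply hφz
    rw [Functor.map_comp]
    exact (congrArg (((t R).map b).hom.app L) hz).trans (map_zero _)

/-- By `gen_injective_and_exact`, `γ` is a kernel of `(t R).map F.pres.f`, as is `kerPresι`; the
counit is the comparison between the two kernels. -/
instance isIso_counit (h : ∀ G, isFp (RMod R) ((restrictedHom (RMod R) (t R)).obj G)) :
    IsIso (kerPresAdj (t R) h).counit := by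
  rw [NatTrans.isIso_iff_isIso_app]
  intro G
  rw [← isIso_unop_iff]
  let F := restrictedHomFp (t R) h G
  let γ : G.unop ⟶ (t R).obj F.pres.X :=
    ((kerPresAdj (t R) h).counit.app G).unop ≫ kerPresι (t R) (op F)
  have hγ := gen_injective_and_exact G.unop F.pres γ (kerPresAdj_counit_ι (t R) h G)
  obtain ⟨κ, hκ⟩ := exists_lift_of_injective γ (fun L => (hγ L).1) (kerPresι (t R) (op F))
    fun L z => (hγ L).2 _ (by
      have h0 := congrArg (fun φ => φ.hom.app L z) (kerPresι_comp (t R) F)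
      exact h0)
  refine ⟨κ, ?_, ?_⟩
  · have : Mono γ := by
      constructor
      intro K α β hαβ
      ext L z
      apply (hγ L).1
      exact congrArg (fun φ => φ.hom.app L z) hαβ
    rw [← cancel_mono γ, Category.assoc, hκ, Category.id_comp]
  · rw [← cancel_mono (kerPresι (t R) (op F)), Category.assoc, Category.id_comp]
    exact hκ

variable (R) in
/-- The Auslander-Gruson-Jensen functor is `kerPres` of the tensor embedding. -/
def DAIso : DA R ≅ kerPres (t R) :=
  kerPresIso (T := t R) (S := (Y (RMod R)).rightOp ⋙ defect ⋙ t R)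
    (Functor.isoWhiskerRight (YDefectIso (RMod R)).symm (t R))

instance (h : ∀ G : (LFun R)ᵒᵖ, isFp (RMod R) ((preDR R).obj G)) : (DR R h).Additive where
  map_add {G G' a b} := by
    apply ObjectProperty.hom_ext
    exact (restrictedHom (RMod R) (t R)).map_add (f := a) (g := b)

end Main

end AGJ

end

theorem mainTheorem2 (R : Type u) [Ring R] :
    ∃ h : ∀ G : (AGJ.LFun R)ᵒᵖ, AGJ.isFp (AGJ.RMod R) ((AGJ.preDR R).obj G),
      (AGJ.DR R h).Additive ∧ (AGJ.DR R h).Full ∧ (AGJ.DR R h).Faithful ∧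
      ∃ adj : (AGJ.DA R).rightOp ⊣ AGJ.DR R h,
        ∀ (F : AGJ.Fp (AGJ.RMod R)) (G : (AGJ.LFun R)ᵒᵖ) (α β : (AGJ.DA R).rightOp.obj F ⟶ G),
          adj.homEquiv F G (α + β) = adj.homEquiv F G α + adj.homEquiv F G β := by
  let adj₀ : (AGJ.kerPres (AGJ.t R)).rightOp ⊣ AGJ.DR R AGJ.isFp_preDR :=
    AGJ.kerPresAdj (AGJ.t R) AGJ.isFp_preDR
  have : IsIso adj₀.counit := AGJ.isIso_counit AGJ.isFp_preDR
  let ff := adj₀.fullyFaithfulROfIsIsoCounit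
  refine ⟨AGJ.isFp_preDR, inferInstance, ff.full, ff.faithful,
    adj₀.ofNatIsoLeft (NatIso.ofComponents (fun F => ((AGJ.DAIso R).app (op F)).op)
      fun {F F'} α => Quiver.Hom.unop_inj ((AGJ.DAIso R).hom.naturality α.op).symm), fun F G α β => ?_⟩
  -- The bijection is `α ↦ unit ≫ D_R α`, so its additivity is that of `D_R`.
  simp only [Adjunction.homEquiv_unit, Functor.map_add, Preadditive.comp_add]
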